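/- Let $\Phi$ be a unital commutative ring and $G$ an abelian group. Let $A=\bigoplus_{\sigma\in G}A_\sigma$ be a $G$-graded semiprime associative $\Phi$-algebra (not necessarily unital) without 2-torsion (that is, $2a=0$ implies $a=0$ for $a\in A$), with a $\Phi$-linear involution $*$ such that $A_\sigma^*=A_\sigma$ for every $\sigma\in G$. Let $Q_s(A)$ be the Martindale symmetric algebra of quotients of $A$, with the involution extending $*$, and let $Q=\bigoplus_{\sigma\in G}Q_\sigma$ be a $G$-graded algebra such that $Q$ is a subalgebra of $Q_s(A)$, $A\subseteq Q$ with $A_\sigma\subseteq Q_\sigma$, and $Q_\sigma^*=Q_\sigma$ for every $\sigma\in G$. For an algebra $R$ with involution, let $K_R=\{x\in R: x^*=-x\}$, a Lie algebra with bracket $[x,y]=xy-yx$; for a Lie algebra $L$ let $Z_L$ be its center and let $[L,L]$ be the linear span of its brackets. The Lie algebras $K_R/Z_{K_R}$ and $[K_R,K_R]/Z_{[K_R,K_R]}$, for $R=A$ and $R=Q$, are considered with the gradings induced by that of $R$. A $G$-graded Lie algebra $M=\bigoplus_\sigma M_\sigma$ is a *graded algebra of quotients* of a graded subalgebra $L=\bigoplus_\sigma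 L_\sigma$ if for all $\sigma,\tau\in G$, $0\neq p\in M_\sigma$ and $q\in M_\tau$ there are $\alpha\in G$ and $x\in L_\alpha$ such that $[x,p]\neq 0$ and $[x,{}_L(q)]\subseteq L$, where ${}_L(q)$ is the linear span in $M$ of $q$ and all elements $\operatorname{ad}_{x_1}\cdots\operatorname{ad}_{x_n}q$ with $n\ge 1$ and $x_1,\dots,x_n\in L$. Then: (i) the inclusion $K_A\subseteq K_Q$ induces an injective homomorphism of graded Lie algebras $K_A/Z_{K_A}\to K_Q/Z_{K_Q}$, and through it $K_Q/Z_{K_Q}$ is a graded algebra of quotients of $K_A/Z_{K_A}$; (ii) the inclusion $[K_A,K_A]\subseteq[K_Q,K_Q]$ induces an injective homomorphism of graded Lie algebras $[K_A,K_A]/Z_{[K_A,K_A]}\to[K_Q,K_Q]/Z_{[K_Q,K_Q]}$, and through it $[K_Q,K_Q]/Z_{[K_Q,K_Q]}$ is a graded algebra of quotients of $[K_A,K_A]/Z_{[K_A,K_A]}$. -/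

import Mathlib

/-! ### Graded algebras of quotients of graded Lie algebras -/

section GradedQuotients

variable {Φ L M G : Type*} [CommRing Φ] [LieRing L] [LieAlgebra Φ L] [LieRing M] [LieAlgebra Φ M]

/-- For a Lie homomorphism `φ : L → M` (the inclusion of `L` when `φ` is injective) and `q : M`,
the linear span of the elements `ad x₁ ⋯ ad xₙ q` with `n ≥ 0` and `x₁, …, xₙ` in `L`
(for `n = 0` this is `q` itself). -/
def adSpan (φ : L →ₗ⁅Φ⁆ M) (q : M) : Submodule Φ M :=
  Submodule.span Φ {y | ∃ l : List L, y = l.foldr (fun x z => ⁅φ x, z⁆) q}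

/-- The Lie algebra `M`, graded by `ℳ`, is a graded algebra of quotients of the Lie algebra `L`,
graded by `ℒ`, where `L` is regarded as a graded subalgebra of `M` through `φ`. -/
structure IsGradedAlgebraOfQuotients [AddCommGroup G] [DecidableEq G] (φ : L →ₗ⁅Φ⁆ M)
    (ℒ : G → Submodule Φ L) (ℳ : G → Submodule Φ M) : Prop where
  /-- `L` is a graded Lie algebra. -/
  isInternal_sub : DirectSum.IsInternal ℒ
  gradedBracket_sub : SetLike.GradedBracket ℒ
  /-- `M` is a graded Lie algebra. -/
  isInternal : DirectSum.IsInternal ℳ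
  gradedBracket : SetLike.GradedBracket ℳ
  /-- `φ` identifies `L` with a graded subalgebra of `M`. -/
  injective : Function.Injective φ
  map_mem : ∀ σ, ∀ x ∈ ℒ σ, φ x ∈ ℳ σ
  /-- For homogeneous `p ≠ 0` and `q` in `M` there is a homogeneous `x` in `L` with `[x, p] ≠ 0`
  and `[x, y] ∈ L` for all `y` in the span of the `ad x₁ ⋯ ad xₙ q`. -/
  absorb : ∀ σ τ, ∀ p ∈ ℳ σ, p ≠ 0 → ∀ q ∈ ℳ τ,
    ∃ α, ∃ x ∈ ℒ α, ⁅φ x, p⁆ ≠ 0 ∧ ∀ y ∈ adSpan φ q, ⁅φ x, y⁆ ∈ φ.range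

/-- The quotient `L / Z_L` of a Lie algebra by its center. -/
abbrev ModCenter (Φ L : Type*) [CommRing Φ] [LieRing L] [LieAlgebra Φ L] : Type _ :=
  L ⧸ LieAlgebra.center Φ L

/-- The projection `L → L / Z_L`. -/
def modCenter (Φ L : Type*) [CommRing Φ] [LieRing L] [LieAlgebra Φ L] :
    L →ₗ⁅Φ⁆ ModCenter Φ L where
  toLinearMap := (LieAlgebra.center Φ L).toSubmodule.mkQ
  map_lie' := rfl

/-- The family of submodules of `L / Z_L` induced by a family of submodules of `L`. -/
def modCenterGrading (ℒ : G → Submodule Φ L) (σ : G) : Submodule Φ (ModCenter Φ L) :=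
  (ℒ σ).map (modCenter Φ L : L →ₗ[Φ] ModCenter Φ L)

/-- The derived algebra `[L, L]` (the linear span of all brackets). -/
abbrev Derived (Φ L : Type*) [CommRing Φ] [LieRing L] [LieAlgebra Φ L] : LieIdeal Φ L :=
  ⁅(⊤ : LieIdeal Φ L), (⊤ : LieIdeal Φ L)⁆

theorem map_mem_Derived (f : L →ₗ⁅Φ⁆ M) (x : L) (hx : x ∈ Derived Φ L) : f x ∈ Derived Φ M :=
  (LieIdeal.map_bracket_le f).trans (LieSubmodule.mono_lie le_top le_top) (LieIdeal.mem_map hx)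

/-- The homomorphism `[L, L] → [M, M]` induced by a homomorphism `L → M`. -/
def derivedMap (f : L →ₗ⁅Φ⁆ M) : Derived Φ L →ₗ⁅Φ⁆ Derived Φ M where
  toFun x := ⟨f x, map_mem_Derived f x x.2⟩
  map_add' x y := Subtype.ext (map_add f (x : L) (y : L))
  map_smul' c x := Subtype.ext (map_smul f c (x : L))
  map_lie' {x y} := Subtype.ext (LieHom.map_lie f (x : L) (y : L))

/-- The family of submodules `[L, L] ∩ L_σ` of `[L, L]`. -/
def derivedGrading (ℒ : G → Submodule Φ L) (σ : G) : Submodule Φ (Derived Φ L) :=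
  (ℒ σ).comap (Derived Φ L).toSubmodule.subtype

end GradedQuotients

/-! ### Skew elements of an associative algebra with involution -/

section Skew

variable (Φ R : Type*) [CommRing Φ] [StarRing Φ] [TrivialStar Φ] [NonUnitalRing R] [StarRing R]
  [Module Φ R] [StarModule Φ R]

/-- `K_R = {x ∈ R | x* = -x}`. -/
abbrev Skew : Type _ := skewAdjoint.submodule Φ R

/-- The bracket of `K_R` is the commutator `[x, y] = xy - yx`. -/
instance Skew.instBracket : Bracket (Skew Φ R) (Skew Φ R) where
  bracket x y := ⟨(x : R) * y - y * x, by
    have hx : star (x : R) = -x := x.2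
    have hy : star (y : R) = -y := y.2
    change star ((x : R) * y - y * x) = -((x : R) * y - y * x)
    simp [hx, hy]⟩

instance Skew.instLieRing : LieRing (Skew Φ R) where
  add_lie x y z := Subtype.ext (by
    change ((x : R) + y) * z - z * (x + y) = (x * z - z * x) + (y * z - z * y)
    noncomm_ring)
  lie_add x y z := Subtype.ext (by
    change (x : R) * (y + z) - (y + z) * x = (x * y - y * x) + (x * z - z * x)
    noncomm_ring)
  lie_self x := Subtype.ext (sub_self _)
  leibniz_lie x y z := Subtype.ext (by
    change (x : R) * (y * z - z * y) - (y * z - z * y) * x =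
      ((x * y - y * x) * z - z * (x * y - y * x)) + (y * (x * z - z * x) - (x * z - z * x) * y)
    noncomm_ring)

instance Skew.instLieAlgebra [IsScalarTower Φ R R] [SMulCommClass Φ R R] :
    LieAlgebra Φ (Skew Φ R) where
  lie_smul c x y := Subtype.ext (by
    change (x : R) * (c • (y : R)) - (c • (y : R)) * x = c • ((x : R) * y - y * x)
    rw [mul_smul_comm, smul_mul_assoc, smul_sub])

variable {Φ R}

/-- The homomorphism `K_R → K_S` induced by a homomorphism of algebras with involution `R → S`. -/
def skewMap {S : Type*} [NonUnitalRing S] [StarRing S] [Module Φ S] [StarModule Φ S]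
    [IsScalarTower Φ R R] [SMulCommClass Φ R R] [IsScalarTower Φ S S] [SMulCommClass Φ S S]
    (f : R →⋆ₙₐ[Φ] S) : Skew Φ R →ₗ⁅Φ⁆ Skew Φ S where
  toFun x := ⟨f x, by
    have hx : star (x : R) = -x := x.2
    change star (f x) = -f x
    rw [← map_star, hx, map_neg]⟩
  map_add' x y := Subtype.ext (map_add f (x : R) y)
  map_smul' c x := Subtype.ext (map_smul f c (x : R))
  map_lie' {x y} := Subtype.ext (by
    change f ((x : R) * y - y * x) = f x * f y - f y * f x
    simp)

/-- The family of submodules `K_R ∩ R_σ` of `K_R`. -/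
def skewGrading {G : Type*} (ℛ : G → Submodule Φ R) (σ : G) : Submodule Φ (Skew Φ R) :=
  (ℛ σ).comap (skewAdjoint.submodule Φ R).subtype

end Skew

/-! ### The Martindale symmetric algebra of quotients -/

/-- A (not necessarily unital) ring `A` is semiprime if `aAa = 0` implies `a = 0`
(equivalently, `A` has no nonzero ideal with zero square). -/
class IsSemiprimeAlg (A : Type*) [NonUnitalRing A] : Prop where
  eq_zero : ∀ a : A, (∀ x : A, a * x * a = 0) → a = 0

namespace Martindale

variable {Φ A : Type*} [CommRing Φ] [NonUnitalRing A] [Module Φ A]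

/-- `J` is a two-sided ideal of the algebra `A` with zero annihilator. When `A` is semiprime these
are exactly the essential ideals. -/
structure IsDenseIdeal (J : Submodule Φ A) : Prop where
  mul_left : ∀ a, ∀ x ∈ J, a * x ∈ J
  mul_right : ∀ a, ∀ x ∈ J, x * a ∈ J
  left_ann : ∀ a : A, (∀ x ∈ J, a * x = 0) → a = 0
  right_ann : ∀ a : A, (∀ x ∈ J, x * a = 0) → a = 0

/-- The restrictions of `f` and `g` to `J` are, respectively, a homomorphism of right `A`-modules
`J → A` and a homomorphism of left `A`-modules `J → A`, and `x f(y) = g(x) y` for `x, y ∈ J`.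
The values of `f` and `g` outside `J` are irrelevant. -/
structure IsCompatiblePair (J : Submodule Φ A) (f g : A → A) : Prop where
  f_add : ∀ x ∈ J, ∀ y ∈ J, f (x + y) = f x + f y
  f_smul : ∀ c : Φ, ∀ x ∈ J, f (c • x) = c • f x
  f_mul : ∀ x ∈ J, ∀ a, f (x * a) = f x * a
  g_add : ∀ x ∈ J, ∀ y ∈ J, g (x + y) = g x + g y
  g_smul : ∀ c : Φ, ∀ x ∈ J, g (c • x) = c • g x
  g_mul : ∀ x ∈ J, ∀ a, g (a * x) = a * g x
  compat : ∀ x ∈ J, ∀ y ∈ J, x * f y = g x * y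

theorem IsDenseIdeal.inf {J J' : Submodule Φ A} (h : IsDenseIdeal J) (h' : IsDenseIdeal J') :
    IsDenseIdeal (J ⊓ J') where
  mul_left a x hx := ⟨h.mul_left a x hx.1, h'.mul_left a x hx.2⟩
  mul_right a x hx := ⟨h.mul_right a x hx.1, h'.mul_right a x hx.2⟩
  left_ann a ha := h.left_ann a fun x hx => h'.left_ann _ fun y hy => by
    rw [mul_assoc]; exact ha _ ⟨h.mul_right y x hx, h'.mul_left x y hy⟩
  right_ann a ha := h.right_ann a fun x hx => h'.right_ann _ fun y hy => by
    rw [← mul_assoc]; exact ha _ ⟨h.mul_left y x hx, h'.mul_right x y hy⟩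

theorem isDenseIdeal_top [IsSemiprimeAlg A] : IsDenseIdeal (⊤ : Submodule Φ A) where
  mul_left _ _ _ := trivial
  mul_right _ _ _ := trivial
  left_ann a ha := IsSemiprimeAlg.eq_zero a fun x => by rw [ha x trivial, zero_mul]
  right_ann a ha := IsSemiprimeAlg.eq_zero a fun x => by rw [mul_assoc, ha _ trivial, mul_zero]

theorem IsCompatiblePair.mono {J J' : Submodule Φ A} {f g : A → A} (h : IsCompatiblePair J f g)
    (hJ : J' ≤ J) : IsCompatiblePair J' f g where
  f_add x hx y hy := h.f_add x (hJ hx) y (hJ hy)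
  f_smul c x hx := h.f_smul c x (hJ hx)
  f_mul x hx := h.f_mul x (hJ hx)
  g_add x hx y hy := h.g_add x (hJ hx) y (hJ hy)
  g_smul c x hx := h.g_smul c x (hJ hx)
  g_mul x hx := h.g_mul x (hJ hx)
  compat x hx y hy := h.compat x (hJ hx) y (hJ hy)

theorem exists_dense [IsScalarTower Φ A A] [SMulCommClass Φ A A] {J I : Submodule Φ A}
    {f g : A → A} (hJ : IsDenseIdeal J) (h : IsCompatiblePair J f g) (hI : IsDenseIdeal I) :
    ∃ K : Submodule Φ A, IsDenseIdeal K ∧ K ≤ I ∧ K ≤ J ∧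
      (∀ x ∈ K, f x ∈ I) ∧ ∀ x ∈ K, g x ∈ I := by
  have f0 : f 0 = 0 := by simpa using h.f_smul 0 0 J.zero_mem
  have g0 : g 0 = 0 := by simpa using h.g_smul 0 0 J.zero_mem
  let K : Submodule Φ A :=
    { carrier := {x | (x ∈ I ∧ x ∈ J) ∧ (f x ∈ I ∧ g x ∈ I) ∧
        (∀ a, f (a * x) ∈ I) ∧ ∀ a, g (x * a) ∈ I}
      zero_mem' := by simp [f0, g0]
      add_mem' := by
        rintro x y ⟨⟨x1, x2⟩, ⟨x3, x4⟩, x5, x6⟩ ⟨⟨y1, y2⟩, ⟨y3, y4⟩, y5, y6⟩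
        refine ⟨⟨I.add_mem x1 y1, J.add_mem x2 y2⟩, ⟨?_, ?_⟩, fun a => ?_, fun a => ?_⟩
        · rw [h.f_add x x2 y y2]; exact I.add_mem x3 y3
        · rw [h.g_add x x2 y y2]; exact I.add_mem x4 y4
        · rw [mul_add, h.f_add _ (hJ.mul_left a x x2) _ (hJ.mul_left a y y2)]
          exact I.add_mem (x5 a) (y5 a)
        · rw [add_mul, h.g_add _ (hJ.mul_right a x x2) _ (hJ.mul_right a y y2)]
          exact I.add_mem (x6 a) (y6 a)
      smul_mem' := by
        rintro c x ⟨⟨x1, x2⟩, ⟨x3, x4⟩, x5, x6⟩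
        refine ⟨⟨I.smul_mem c x1, J.smul_mem c x2⟩, ⟨?_, ?_⟩, fun a => ?_, fun a => ?_⟩
        · rw [h.f_smul c x x2]; exact I.smul_mem c x3
        · rw [h.g_smul c x x2]; exact I.smul_mem c x4
        · rw [mul_smul_comm, h.f_smul c _ (hJ.mul_left a x x2)]; exact I.smul_mem c (x5 a)
        · rw [smul_mul_assoc, h.g_smul c _ (hJ.mul_right a x x2)]; exact I.smul_mem c (x6 a) }
  have key : ∀ i ∈ I, ∀ j ∈ J, ∀ i' ∈ I, i * j * i' ∈ K := by
    intro i hi j hj i' hi'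
    have hij : i * j ∈ J := hJ.mul_left i j hj
    refine ⟨⟨hI.mul_left _ _ hi', hJ.mul_right _ _ hij⟩, ⟨?_, ?_⟩, fun a => ?_, fun a => ?_⟩
    · rw [h.f_mul _ hij]; exact hI.mul_left _ _ hi'
    · rw [mul_assoc, h.g_mul _ (hJ.mul_right _ _ hj)]; exact hI.mul_right _ _ hi
    · rw [← mul_assoc, h.f_mul _ (hJ.mul_left _ _ hij)]; exact hI.mul_left _ _ hi'
    · rw [mul_assoc, mul_assoc, h.g_mul _ (hJ.mul_right _ _ hj)]; exact hI.mul_right _ _ hi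
  refine ⟨K, ⟨?_, ?_, ?_, ?_⟩, fun x hx => hx.1.1, fun x hx => hx.1.2, fun x hx => hx.2.1.1,
    fun x hx => hx.2.1.2⟩
  · rintro a x ⟨⟨x1, x2⟩, ⟨x3, x4⟩, x5, x6⟩
    refine ⟨⟨hI.mul_left _ _ x1, hJ.mul_left _ _ x2⟩, ⟨x5 a, ?_⟩, fun b => ?_, fun b => ?_⟩
    · rw [h.g_mul x x2]; exact hI.mul_left _ _ x4
    · rw [← mul_assoc]; exact x5 _
    · rw [mul_assoc, h.g_mul _ (hJ.mul_right _ _ x2)]; exact hI.mul_left _ _ (x6 b)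
  · rintro a x ⟨⟨x1, x2⟩, ⟨x3, x4⟩, x5, x6⟩
    refine ⟨⟨hI.mul_right _ _ x1, hJ.mul_right _ _ x2⟩, ⟨?_, x6 a⟩, fun b => ?_, fun b => ?_⟩
    · rw [h.f_mul x x2]; exact hI.mul_right _ _ x3
    · rw [← mul_assoc, h.f_mul _ (hJ.mul_left _ _ x2)]; exact hI.mul_right _ _ (x5 b)
    · rw [mul_assoc]; exact x6 _
  · intro a ha
    refine hI.left_ann a fun i hi => hJ.left_ann _ fun j hj => hI.left_ann _ fun i' hi' => ?_
    have := ha _ (key i hi j hj i' hi')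
    simpa [mul_assoc] using this
  · intro a ha
    refine hI.right_ann a fun i hi => hJ.right_ann _ fun j hj => hI.right_ann _ fun i' hi' => ?_
    have := ha _ (key i' hi' j hj i hi)
    simpa [mul_assoc] using this

theorem IsDenseIdeal.exists_star [StarRing Φ] [TrivialStar Φ] [StarRing A] [StarModule Φ A]
    {J : Submodule Φ A} (h : IsDenseIdeal J) :
    ∃ K : Submodule Φ A, IsDenseIdeal K ∧ ∀ x, x ∈ K ↔ star x ∈ J := by
  let K : Submodule Φ A :=
    { carrier := {x | star x ∈ J}
      zero_mem' := by simp
      add_mem' := by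
        intro x y hx hy
        simpa using J.add_mem hx hy
      smul_mem' := by
        intro c x hx
        simpa using J.smul_mem c hx }
  have hK : ∀ x, x ∈ K ↔ star x ∈ J := fun x => Iff.rfl
  refine ⟨K, ⟨fun a x hx => ?_, fun a x hx => ?_, fun a ha => ?_, fun a ha => ?_⟩, hK⟩
  · rw [hK, star_mul]; exact h.mul_right _ _ hx
  · rw [hK, star_mul]; exact h.mul_left _ _ hx
  · refine star_eq_zero.1 (h.right_ann _ fun x hx => ?_)
    have := ha (star x) (by rw [hK, star_star]; exact hx)
    simpa using congrArg star this
  · refine star_eq_zero.1 (h.left_ann _ fun x hx => ?_)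
    have := ha (star x) (by rw [hK, star_star]; exact hx)
    simpa using congrArg star this

theorem isCompatiblePair_comp {J I K : Submodule Φ A} {f g f' g' : A → A}
    (h : IsCompatiblePair J f g) (h' : IsCompatiblePair I f' g') (hKJ : K ≤ J) (hKI : K ≤ I)
    (hf : ∀ x ∈ K, f' x ∈ J) (hg : ∀ x ∈ K, g x ∈ I) :
    IsCompatiblePair K (fun x => f (f' x)) (fun x => g' (g x)) where
  f_add x hx y hy := by rw [h'.f_add x (hKI hx) y (hKI hy), h.f_add _ (hf x hx) _ (hf y hy)]
  f_smul c x hx := by rw [h'.f_smul c x (hKI hx), h.f_smul c _ (hf x hx)]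
  f_mul x hx a := by rw [h'.f_mul x (hKI hx), h.f_mul _ (hf x hx)]
  g_add x hx y hy := by rw [h.g_add x (hKJ hx) y (hKJ hy), h'.g_add _ (hg x hx) _ (hg y hy)]
  g_smul c x hx := by rw [h.g_smul c x (hKJ hx), h'.g_smul c _ (hg x hx)]
  g_mul x hx a := by rw [h.g_mul x (hKJ hx), h'.g_mul _ (hg x hx)]
  compat x hx y hy := by
    rw [h.compat x (hKJ hx) _ (hf y hy), h'.compat _ (hg x hx) y (hKI hy)]

variable (Φ A) [IsScalarTower Φ A A] [SMulCommClass Φ A A] [IsSemiprimeAlg A]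

/-- The pairs `(f, g)` that are compatible on some dense ideal. -/
def pairs : Submodule Φ ((A → A) × (A → A)) where
  carrier := {p | ∃ J : Submodule Φ A, IsDenseIdeal J ∧ IsCompatiblePair J p.1 p.2}
  zero_mem' := ⟨⊤, isDenseIdeal_top, by constructor <;> simp⟩
  add_mem' := by
    rintro p q ⟨J, hJ, hp⟩ ⟨I, hI, hq⟩
    refine ⟨J ⊓ I, hJ.inf hI, ?_⟩
    have hp := hp.mono (inf_le_left : J ⊓ I ≤ J)
    have hq := hq.mono (inf_le_right : J ⊓ I ≤ I)
    constructor
    · intro x hx y hy; simp [hp.f_add x hx y hy, hq.f_add x hx y hy]; abel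
    · intro c x hx; simp [hp.f_smul c x hx, hq.f_smul c x hx]
    · intro x hx a; simp [hp.f_mul x hx, hq.f_mul x hx, add_mul]
    · intro x hx y hy; simp [hp.g_add x hx y hy, hq.g_add x hx y hy]; abel
    · intro c x hx; simp [hp.g_smul c x hx, hq.g_smul c x hx]
    · intro x hx a; simp [hp.g_mul x hx, hq.g_mul x hx, mul_add]
    · intro x hx y hy; simp [mul_add, add_mul, hp.compat x hx y hy, hq.compat x hx y hy]
  smul_mem' := by
    rintro c p ⟨J, hJ, hp⟩
    refine ⟨J, hJ, ?_⟩
    constructor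
    · intro x hx y hy; simp [hp.f_add x hx y hy]
    · intro d x hx; simp [hp.f_smul d x hx, smul_comm c d]
    · intro x hx a; simp [hp.f_mul x hx, smul_mul_assoc]
    · intro x hx y hy; simp [hp.g_add x hx y hy]
    · intro d x hx; simp [hp.g_smul d x hx, smul_comm c d]
    · intro x hx a; simp [hp.g_mul x hx, mul_smul_comm]
    · intro x hx y hy; simp [hp.compat x hx y hy, mul_smul_comm, smul_mul_assoc]

/-- The pairs `(f, g)` that vanish on some dense ideal. -/
def nullPairs : Submodule Φ (pairs Φ A) where
  carrier := {p | ∃ J : Submodule Φ A, IsDenseIdeal J ∧ ∀ x ∈ J, p.1.1 x = 0 ∧ p.1.2 x = 0}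
  zero_mem' := ⟨⊤, isDenseIdeal_top, by simp⟩
  add_mem' := by
    rintro p q ⟨J, hJ, hp⟩ ⟨I, hI, hq⟩
    exact ⟨J ⊓ I, hJ.inf hI, fun x hx => by simp [hp x hx.1, hq x hx.2]⟩
  smul_mem' := by
    rintro c p ⟨J, hJ, hp⟩
    exact ⟨J, hJ, fun x hx => by simp [hp x hx]⟩

/-- The Martindale symmetric algebra of quotients `Q_s(A)` of a semiprime algebra `A`: classes of
compatible pairs `(f, g)` defined on dense (that is, essential) ideals, two pairs being identified
when they agree on some dense ideal. The class of `(f, g)` is the element `q` with `q x = f(x)` and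
`x q = g(x)` for `x` in that ideal. -/
def Qs : Type _ := pairs Φ A ⧸ nullPairs Φ A

namespace Qs

instance : AddCommGroup (Qs Φ A) := inferInstanceAs (AddCommGroup (pairs Φ A ⧸ nullPairs Φ A))

instance : Module Φ (Qs Φ A) := inferInstanceAs (Module Φ (pairs Φ A ⧸ nullPairs Φ A))

variable {Φ A}

/-- The class of a pair. -/
def mk : pairs Φ A →ₗ[Φ] Qs Φ A := (nullPairs Φ A).mkQ

theorem mk_surjective : Function.Surjective (mk : pairs Φ A →ₗ[Φ] Qs Φ A) :=
  (nullPairs Φ A).mkQ_surjective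

theorem mk_eq_mk {p q : pairs Φ A} :
    mk p = mk q ↔ ∃ J : Submodule Φ A, IsDenseIdeal J ∧
      ∀ x ∈ J, p.1.1 x = q.1.1 x ∧ p.1.2 x = q.1.2 x := by
  refine (Submodule.Quotient.eq (nullPairs Φ A)).trans ?_
  refine exists_congr fun J => and_congr_right fun _ => forall₂_congr fun x _ => ?_
  exact and_congr sub_eq_zero sub_eq_zero

/-- Product of pairs: `(f, g)(f', g') = (f ∘ f', g' ∘ g)`. -/
def mulPair (p q : pairs Φ A) : pairs Φ A :=
  ⟨(fun x => p.1.1 (q.1.1 x), fun x => q.1.2 (p.1.2 x)), by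
    obtain ⟨J, hJ, hp⟩ := p.2
    obtain ⟨I, hI, hq⟩ := q.2
    obtain ⟨K, hK, hKI, hKJ, -, hgK⟩ := exists_dense hJ hp hI
    obtain ⟨K', hK', hKJ', hKI', hfK', -⟩ := exists_dense hI hq hJ
    exact ⟨K ⊓ K', hK.inf hK', isCompatiblePair_comp (f := p.1.1) (g' := q.1.2) hp hq (inf_le_left.trans hKJ)
      (inf_le_left.trans hKI) (fun x hx => hfK' x hx.2) fun x hx => hgK x hx.1⟩⟩

theorem mulPair_congr {p p' q q' : pairs Φ A} (hp : mk p = mk p') (hq : mk q = mk q') :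
    mk (mulPair p q) = mk (mulPair p' q') := by
  obtain ⟨J, hJ, hp⟩ := mk_eq_mk.1 hp
  obtain ⟨I, hI, hq⟩ := mk_eq_mk.1 hq
  obtain ⟨J₁, hJ₁, h₁⟩ := p.2
  obtain ⟨I₁, hI₁, h₂⟩ := q.2
  obtain ⟨K, hK, hKI, hKJ, -, hgK⟩ := exists_dense hJ₁ h₁ hI
  obtain ⟨K', hK', hKJ', hKI', hfK', -⟩ := exists_dense hI₁ h₂ hJ
  refine mk_eq_mk.2 ⟨K ⊓ K', hK.inf hK', fun x hx => ⟨?_, ?_⟩⟩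
  · change p.1.1 (q.1.1 x) = p'.1.1 (q'.1.1 x)
    rw [← (hq x (hKI hx.1)).1, (hp _ (hfK' x hx.2)).1]
  · change q.1.2 (p.1.2 x) = q'.1.2 (p'.1.2 x)
    rw [← (hp x (hKJ' hx.2)).2, (hq _ (hgK x hx.1)).2]

instance : Mul (Qs Φ A) where
  mul := Quotient.map₂ mulPair fun _ _ hp _ _ hq =>
    Quotient.exact (mulPair_congr (Quotient.sound hp) (Quotient.sound hq))

theorem mk_mul_mk (p q : pairs Φ A) : mk p * mk q = mk (mulPair p q) := rfl

instance : NonUnitalRing (Qs Φ A) where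
  left_distrib := by
    intro a b c
    obtain ⟨p, rfl⟩ := mk_surjective a
    obtain ⟨q, rfl⟩ := mk_surjective b
    obtain ⟨r, rfl⟩ := mk_surjective c
    rw [← map_add, mk_mul_mk, mk_mul_mk, mk_mul_mk, ← map_add, mk_eq_mk]
    obtain ⟨J, hJ, hp⟩ := p.2
    obtain ⟨I, hI, hq⟩ := q.2
    obtain ⟨I', hI', hr⟩ := r.2
    obtain ⟨K, hK, -, -, hf, -⟩ := exists_dense hI hq hJ
    obtain ⟨K', hK', -, -, hf', -⟩ := exists_dense hI' hr hJ
    exact ⟨K ⊓ K', hK.inf hK', fun x hx => ⟨hp.f_add _ (hf x hx.1) _ (hf' x hx.2), rfl⟩⟩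
  right_distrib := by
    intro a b c
    obtain ⟨p, rfl⟩ := mk_surjective a
    obtain ⟨q, rfl⟩ := mk_surjective b
    obtain ⟨r, rfl⟩ := mk_surjective c
    rw [← map_add, mk_mul_mk, mk_mul_mk, mk_mul_mk, ← map_add, mk_eq_mk]
    obtain ⟨J, hJ, hp⟩ := p.2
    obtain ⟨I, hI, hq⟩ := q.2
    obtain ⟨I', hI', hr⟩ := r.2
    obtain ⟨K, hK, -, -, -, hg⟩ := exists_dense hJ hp hI'
    obtain ⟨K', hK', -, -, -, hg'⟩ := exists_dense hI hq hI'
    exact ⟨K ⊓ K', hK.inf hK', fun x hx => ⟨rfl, hr.g_add _ (hg x hx.1) _ (hg' x hx.2)⟩⟩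
  zero_mul := by
    intro a
    obtain ⟨p, rfl⟩ := mk_surjective a
    rw [← map_zero mk, mk_mul_mk, mk_eq_mk]
    obtain ⟨J, hJ, hp⟩ := p.2
    have h0 : p.1.2 0 = 0 := by simpa using hp.g_smul 0 0 J.zero_mem
    exact ⟨⊤, isDenseIdeal_top, fun x _ => ⟨rfl, h0⟩⟩
  mul_zero := by
    intro a
    obtain ⟨p, rfl⟩ := mk_surjective a
    rw [← map_zero mk, mk_mul_mk, mk_eq_mk]
    obtain ⟨J, hJ, hp⟩ := p.2
    have h0 : p.1.1 0 = 0 := by simpa using hp.f_smul 0 0 J.zero_mem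
    exact ⟨⊤, isDenseIdeal_top, fun x _ => ⟨h0, rfl⟩⟩
  mul_assoc := by
    intro a b c
    obtain ⟨p, rfl⟩ := mk_surjective a
    obtain ⟨q, rfl⟩ := mk_surjective b
    obtain ⟨r, rfl⟩ := mk_surjective c
    rfl

instance : IsScalarTower Φ (Qs Φ A) (Qs Φ A) where
  smul_assoc := by
    intro c a b
    obtain ⟨p, rfl⟩ := mk_surjective a
    obtain ⟨q, rfl⟩ := mk_surjective b
    rw [smul_eq_mul, smul_eq_mul, ← map_smul, mk_mul_mk, mk_mul_mk, ← map_smul, mk_eq_mk]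
    obtain ⟨J, hJ, hp⟩ := p.2
    obtain ⟨I, hI, hq⟩ := q.2
    obtain ⟨K, hK, -, -, -, hg⟩ := exists_dense hJ hp hI
    exact ⟨K, hK, fun x hx => ⟨rfl, hq.g_smul c _ (hg x hx)⟩⟩

instance : SMulCommClass Φ (Qs Φ A) (Qs Φ A) where
  smul_comm := by
    intro c a b
    obtain ⟨p, rfl⟩ := mk_surjective a
    obtain ⟨q, rfl⟩ := mk_surjective b
    rw [smul_eq_mul, smul_eq_mul, ← map_smul, mk_mul_mk, mk_mul_mk, ← map_smul, mk_eq_mk]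
    obtain ⟨J, hJ, hp⟩ := p.2
    obtain ⟨I, hI, hq⟩ := q.2
    obtain ⟨K, hK, -, -, hf, -⟩ := exists_dense hI hq hJ
    exact ⟨K, hK, fun x hx => ⟨(hp.f_smul c _ (hf x hx)).symm, rfl⟩⟩

section Star

variable [StarRing Φ] [TrivialStar Φ] [StarRing A] [StarModule Φ A]

/-- The involution on pairs: since `q* x = (x* q)*` and `x q* = (q x*)*`, it sends `(f, g)` to
`(x ↦ g(x*)*, x ↦ f(x*)*)`. -/
def starPair (p : pairs Φ A) : pairs Φ A :=
  ⟨(fun x => star (p.1.2 (star x)), fun x => star (p.1.1 (star x))), by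
    obtain ⟨J, hJ, hp⟩ := p.2
    obtain ⟨K, hK, h⟩ := hJ.exists_star
    refine ⟨K, hK, ?_⟩
    constructor
    · intro x hx y hy; simp [hp.g_add _ ((h x).1 hx) _ ((h y).1 hy)]
    · intro c x hx; simp [hp.g_smul c _ ((h x).1 hx)]
    · intro x hx a; simp [hp.g_mul _ ((h x).1 hx)]
    · intro x hx y hy; simp [hp.f_add _ ((h x).1 hx) _ ((h y).1 hy)]
    · intro c x hx; simp [hp.f_smul c _ ((h x).1 hx)]
    · intro x hx a; simp [hp.f_mul _ ((h x).1 hx)]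
    · intro x hx y hy
      have := congrArg star (hp.compat _ ((h y).1 hy) _ ((h x).1 hx))
      simpa using this.symm⟩

theorem starPair_congr {p p' : pairs Φ A} (hp : mk p = mk p') :
    mk (starPair p) = mk (starPair p') := by
  obtain ⟨J, hJ, hp⟩ := mk_eq_mk.1 hp
  obtain ⟨K, hK, h⟩ := hJ.exists_star
  exact mk_eq_mk.2 ⟨K, hK, fun x hx => ⟨congrArg star (hp _ ((h x).1 hx)).2,
    congrArg star (hp _ ((h x).1 hx)).1⟩⟩

instance : Star (Qs Φ A) where
  star := Quotient.map starPair fun _ _ hp => Quotient.exact (starPair_congr (Quotient.sound hp))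

theorem star_mk (p : pairs Φ A) : star (mk p) = mk (starPair p) := rfl

instance : StarRing (Qs Φ A) where
  star_involutive := by
    intro a
    obtain ⟨p, rfl⟩ := mk_surjective a
    rw [star_mk, star_mk, mk_eq_mk]
    exact ⟨⊤, isDenseIdeal_top, fun x _ => by simp [starPair]⟩
  star_mul := by
    intro a b
    obtain ⟨p, rfl⟩ := mk_surjective a
    obtain ⟨q, rfl⟩ := mk_surjective b
    rw [star_mk, star_mk, mk_mul_mk, mk_mul_mk, star_mk, mk_eq_mk]
    exact ⟨⊤, isDenseIdeal_top, fun x _ => by simp [starPair, mulPair]⟩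
  star_add := by
    intro a b
    obtain ⟨p, rfl⟩ := mk_surjective a
    obtain ⟨q, rfl⟩ := mk_surjective b
    rw [star_mk, star_mk, ← map_add, ← map_add, star_mk, mk_eq_mk]
    exact ⟨⊤, isDenseIdeal_top, fun x _ => by simp [starPair]⟩

instance : StarModule Φ (Qs Φ A) where
  star_smul := by
    intro c a
    obtain ⟨p, rfl⟩ := mk_surjective a
    rw [star_trivial c, star_mk, ← map_smul, ← map_smul, star_mk, mk_eq_mk]
    exact ⟨⊤, isDenseIdeal_top, fun x _ => by simp [starPair]⟩

/-- The pair `(x ↦ a x, x ↦ x a)`. -/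
def multPair (a : A) : pairs Φ A :=
  ⟨(fun x => a * x, fun x => x * a), ⊤, isDenseIdeal_top, by
    constructor <;> simp [mul_add, add_mul, mul_assoc, mul_smul_comm, smul_mul_assoc]⟩

variable (Φ A) in
/-- The canonical embedding `A → Q_s(A)`. -/
def incl : A →⋆ₙₐ[Φ] Qs Φ A where
  toFun a := mk (multPair a)
  map_smul' c a := by
    rw [MonoidHom.id_apply, ← map_smul, mk_eq_mk]
    exact ⟨⊤, isDenseIdeal_top, fun x _ => by simp [multPair, mul_smul_comm, smul_mul_assoc]⟩
  map_zero' := by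
    rw [← map_zero mk, mk_eq_mk]
    exact ⟨⊤, isDenseIdeal_top, fun x _ => by simp [multPair]⟩
  map_add' a b := by
    rw [← map_add, mk_eq_mk]
    exact ⟨⊤, isDenseIdeal_top, fun x _ => by simp [multPair, add_mul, mul_add]⟩
  map_mul' a b := by
    rw [mk_mul_mk, mk_eq_mk]
    exact ⟨⊤, isDenseIdeal_top, fun x _ => by simp [multPair, mulPair, mul_assoc]⟩
  map_star' a := by
    rw [star_mk, mk_eq_mk]
    exact ⟨⊤, isDenseIdeal_top, fun x _ => by simp [multPair, starPair]⟩

/-- The inclusion `K_A → K_Q`, for a `*`-subalgebra `Q` of `Q_s(A)` that contains `A`. -/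
def skewIncl (Q : NonUnitalStarSubalgebra Φ (Qs Φ A)) (hAQ : ∀ a, incl Φ A a ∈ Q) :
    Skew Φ A →ₗ⁅Φ⁆ Skew Φ Q :=
  skewMap (NonUnitalStarAlgHom.codRestrict (incl Φ A) Q hAQ)

end Star

end Qs

end Martindale

/-! ### Skew elements of semiprime rings with involution -/

section SemiprimeInvolution

variable {R : Type*} [NonUnitalRing R] [StarRing R]

/-! Everything reduces to statements about centralizers of skew elements. Let `q` in `K_Q` be
homogeneous. The elements of `A` that multiply `q` into `A` contain an essential ideal, and the
largest ideal `I` of this kind (`absorbIdeal`) is graded because `q` is homogeneous and `*`-stable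
because `q` is skew. The elements of `Q` that `I` multiplies into `A` from both sides are stable
under bracketing with `A`. Hence every skew `x` in `I` carries the whole span of the `ad x₁ ⋯ ad xₙ
q` into `K_A`. In the derived case `x` is replaced by `[x, y]` with `x`, `y` skew in `I`, and the
Jacobi identity puts the result in `[K_A, K_A]`.

It remains to find such a homogeneous `x` with `[x, p]` noncentral when `p` is noncentral. If there
were none, then, `I` being graded, `[p, K_I]` would be central in `K_Q` (respectively, `[p, [K_I,
K_I]]` in `[K_Q, K_Q]`). This forces `p` to commute with `K_Q`, by `commute_skew_of_commutator` and
`commute_skew_of_commutator_derived`.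

Two facts carry these. In a semiprime ring with involution and without 2-torsion,
`commute_skew_of_commute_derived` shows that a skew element centralizing `[K, K]` centralizes `K`.
And `commute_skew_of_commute_skew_mem` shows that a skew element of `Q` commuting with `K_I`
commutes with `K_Q`. The same two facts show that centers map into centers. The recurring device is
that certain expressions in skew elements (`xyx`, `x²y + yx²`, and `xs + sx` for symmetric `s`) are
again skew, so a commutation hypothesis may be applied to them; suspected nonzero elements are then
shown to be nilpotent and killed by semiprimeness. -/

theorem star_commutator_eq_neg {x y : R} (hx : star x = -x) (hy : star y = -y) :
    star (x * y - y * x) = -(x * y - y * x) := by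
  simp [hx, hy]

theorem star_triple_eq_neg {x y : R} (hx : star x = -x) (hy : star y = -y) :
    star (x * y * x) = -(x * y * x) := by
  simp [hx, hy, mul_assoc]

theorem star_jordan_sq_eq_neg {x y : R} (hx : star x = -x) (hy : star y = -y) :
    star (x * x * y + y * x * x) = -(x * x * y + y * x * x) := by
  simp only [star_add, star_mul, hx, hy]
  noncomm_ring

theorem star_jordan_eq_neg {x s : R} (hx : star x = -x) (hs : star s = s) :
    star (x * s + s * x) = -(x * s + s * x) := by
  simp only [star_add, star_mul, hx, hs]
  noncomm_ring

theorem star_add_star_self (a : R) : star (a + star a) = a + star a := by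
  rw [star_add, star_star, add_comm]

theorem star_sub_star_self (a : R) : star (a - star a) = -(a - star a) := by
  rw [star_sub, star_star, neg_sub]

/-- Additive maps that vanish on symmetric and on skew elements vanish. -/
theorem eq_zero_of_symm_of_skew {S : Type*} [AddCommGroup S] (h2 : ∀ a : S, a + a = 0 → a = 0)
    (F : R →+ S) (hs : ∀ s, star s = s → F s = 0) (hk : ∀ k, star k = -k → F k = 0) (a : R) :
    F a = 0 := by
  refine h2 _ ?_
  rw [← map_add, show a + a = (a + star a) + (a - star a) by abel, map_add,
    hs _ (star_add_star_self a), hk _ (star_sub_star_self a), add_zero]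

omit [StarRing R] in
theorem eq_zero_of_central_of_sq [IsSemiprimeAlg R] {c : R} (hc : ∀ a, c * a = a * c)
    (h : c * c = 0) : c = 0 :=
  IsSemiprimeAlg.eq_zero c fun a => by rw [hc, mul_assoc, h, mul_zero]

/-- Since `v(a - a*)v = 0`, the map `a ↦ vav` does not distinguish `a` from `a*`. A suitable skew
element then gives `vavav = 0`, and linearizing this identity leads to semiprimeness. -/
theorem eq_zero_of_skew_sandwich [IsSemiprimeAlg R] (h2 : ∀ a : R, a + a = 0 → a = 0) {v : R}
    (hv : star v = -v)
    (h : ∀ k, star k = -k → v * k * v = 0) : v = 0 := by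
  have h1 : ∀ a, v * star a * v = v * a * v := fun a => by
    have := h _ (star_sub_star_self a)
    rw [mul_sub, sub_mul, sub_eq_zero] at this
    exact this.symm
  have h3 : ∀ a, v * a * v * a * v = 0 := fun a => by
    have e : star ((a + star a) * v * (a + star a)) = -((a + star a) * v * (a + star a)) := by
      simp only [star_mul, star_add, star_star, hv]; noncomm_ring
    have e1 := h _ e
    have e2 : v * (a + star a) * v = v * a * v + v * a * v := by rw [mul_add, add_mul, h1]
    have e3 : v * ((a + star a) * v * (a + star a)) * v =
        (v * a * v * a * v + v * a * v * a * v) + (v * a * v * a * v + v * a * v * a * v) := by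
      have e4 : v * ((a + star a) * v * (a + star a)) * v =
          (v * (a + star a) * v) * (a + star a) * v := by simp only [mul_assoc]
      have e5 : (v * a * v + v * a * v) * (a + star a) * v =
          v * a * (v * (a + star a) * v) + v * a * (v * (a + star a) * v) := by
        simp only [mul_assoc, add_mul]
      rw [e4, e2, e5, e2]
      simp only [mul_assoc, mul_add]
    exact h2 _ (h2 _ (e3.symm.trans e1))
  have h4 : ∀ a b, v * a * v * b * v = -(v * b * v * a * v) := fun a b => by
    have e := h3 (a + b)
    have ea := h3 a
    have eb := h3 b
    rw [eq_neg_iff_add_eq_zero]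
    calc _ = v * (a + b) * v * (a + b) * v - v * a * v * a * v - v * b * v * b * v := by
          noncomm_ring
      _ = 0 := by rw [e, ea, eb]; simp
  -- By `h4`, `a` anticommutes past anything placed between two factors `v`. Moving it past `bvc` as
  -- a block costs one sign, moving it past `b` and then `c` costs two, so the product is its own
  -- negative.
  have h5 : ∀ a b c, v * b * v * c * v * a * v = 0 := fun a b c => by
    refine h2 _ ?_
    have e1 := h4 a (b * v * c)
    have e2 : v * a * v * b * v * c * v = -(v * b * v * a * v * c * v) := by
      rw [h4 a b, neg_mul, neg_mul]
    have e3 : v * b * (v * a * v * c * v) = -(v * b * (v * c * v * a * v)) := by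
      rw [h4 a c, mul_neg]
    simp only [mul_assoc] at e1 e2 e3 ⊢
    rw [e2, e3, neg_neg] at e1
    exact eq_neg_iff_add_eq_zero.1 e1
  refine IsSemiprimeAlg.eq_zero v fun a => IsSemiprimeAlg.eq_zero _ fun c => ?_
  have := h5 a a c
  simp only [mul_assoc] at this ⊢
  exact this

/-- For symmetric `s` the element `cs + sc` is skew, and `c(cs + sc) = (cs + sc)c` says that `c²s =
sc²`. -/
theorem sq_central_of_central_skew (h2 : ∀ a : R, a + a = 0 → a = 0) {c : R}
    (hc : star c = -c)
    (h : ∀ k, star k = -k → c * k = k * c) (a : R) : c * c * a = a * (c * c) := by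
  rw [← sub_eq_zero]
  refine eq_zero_of_symm_of_skew h2
    (AddMonoidHom.mulLeft (c * c) - AddMonoidHom.mulRight (c * c) : R →+ R) ?_ ?_ a
  · intro s hs
    change c * c * s - s * (c * c) = 0
    have := sub_eq_zero.2 (h _ (star_jordan_eq_neg hc hs))
    rw [← this]; noncomm_ring
  · intro k hk
    change c * c * k - k * (c * c) = 0
    rw [mul_assoc, h k hk, ← mul_assoc, h k hk, mul_assoc, sub_self]

/-- Here `c²` is central with square zero, hence zero; then `ckc = kc² = 0` for all skew `k`. -/
theorem eq_zero_of_central_skew_of_cube [IsSemiprimeAlg R]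
    (h2 : ∀ a : R, a + a = 0 → a = 0) {c : R} (hc : star c = -c)
    (h : ∀ k, star k = -k → c * k = k * c) (h3 : c * c * c = 0) : c = 0 := by
  have hcc : c * c = 0 := eq_zero_of_central_of_sq (sq_central_of_central_skew h2 hc h) (by
    rw [← mul_assoc, h3, zero_mul])
  exact eq_zero_of_skew_sandwich h2 hc fun k hk => by
    rw [h k hk, mul_assoc, hcc, mul_zero]

/-- The last hypothesis is `2c²p = 0`, and `c³ = c²[p, x] = c²px - xc²p`. -/
theorem cube_eq_zero_of_commutator {R : Type*} [NonUnitalRing R]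
    (h2 : ∀ a : R, a + a = 0 → a = 0) {p x c : R} (h : p * x - x * p = c) (hp : c * p = p * c)
    (hx : c * x = x * c) (h0 : c * (p * c + c * p) = 0) : c * c * c = 0 := by
  have h1 : c * c * p = 0 := h2 _ (by rw [← h0, mul_add, ← hp, mul_assoc])
  have h3 : c * c * x = x * (c * c) := by rw [mul_assoc, hx, ← mul_assoc, hx, mul_assoc]
  have h4 : c * c * (p * x - x * p) = c * c * p * x - c * c * x * p := by noncomm_ring
  rw [h, h3, h1, mul_assoc x, h1] at h4
  simpa using h4

/-- As `pv + vp = [p², x]` and `c` commutes with `p` and `x`, twice the claim is `[p²c + cp², x] =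
0`. -/
theorem mul_jordan_eq_zero_of_commute {R : Type*} [NonUnitalRing R]
    (h2 : ∀ a : R, a + a = 0 → a = 0) {p x v c : R} (hv : p * x - x * p = v)
    (hx : c * x = x * c) (h : (p * p * c + c * p * p) * x = x * (p * p * c + c * p * p))
    (hp : c * p = p * c) : c * (p * v + v * p) = 0 := by
  have e : p * p * c = c * p * p := by rw [mul_assoc, ← hp, ← mul_assoc, ← hp]
  refine h2 _ ?_
  rw [e] at h
  have h3 : c * (p * v + v * p) = c * p * p * x - x * c * p * p := by
    rw [← hv, ← hx]; noncomm_ring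
  rw [h3]
  rw [← sub_eq_zero] at h
  rw [← h]; noncomm_ring

/-- If `(ad y)² K = 0` then `y²` is central. -/
theorem sq_central_of_ad_sq {R : Type*} [NonUnitalRing R] [StarRing R] [IsSemiprimeAlg R]
    (h2 : ∀ a : R, a + a = 0 → a = 0) {y : R} (hy : star y = -y)
    (h : ∀ k, star k = -k → y * (y * k - k * y) - (y * k - k * y) * y = 0) (a : R) :
    y * y * a = a * (y * y) := by
  -- Since `ad y² = ad y ∘ (L_y + R_y)`, the value at a symmetric `s` is `(ad y)²` of the skew
  -- element `ys + sy`; at a skew `k` it is the anticommutator of `y` with `(ad y)² k`.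
  have h1 : ∀ a, y * y * (y * a - a * y) - (y * a - a * y) * (y * y) = 0 := by
    refine eq_zero_of_symm_of_skew h2
      ((AddMonoidHom.mulLeft (y * y) - AddMonoidHom.mulRight (y * y)).comp
        (AddMonoidHom.mulLeft y - AddMonoidHom.mulRight y) : R →+ R) ?_ ?_
    · intro s hs
      change y * y * (y * s - s * y) - (y * s - s * y) * (y * y) = 0
      rw [← h _ (star_jordan_eq_neg hy hs)]; noncomm_ring
    · intro k hk
      change y * y * (y * k - k * y) - (y * k - k * y) * (y * y) = 0
      have := h k hk
      calc _ = y * (y * (y * k - k * y) - (y * k - k * y) * y) +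
            (y * (y * k - k * y) - (y * k - k * y) * y) * y := by noncomm_ring
        _ = 0 := by rw [this]; simp
  have h3 : ∀ a, y * y * (y * y * a - a * (y * y)) - (y * y * a - a * (y * y)) * (y * y) = 0 := by
    intro a
    calc _ = y * (y * y * (y * a - a * y) - (y * a - a * y) * (y * y)) +
          (y * y * (y * a - a * y) - (y * a - a * y) * (y * y)) * y := by noncomm_ring
      _ = 0 := by rw [h1]; simp
  generalize y * y = t at h3
  -- The Leibniz rule: `(ad t)²(ab) = 2[t, a][t, b]` once `(ad t)²` vanishes at `a` and at `b`.
  have h4 : ∀ a b, (t * a - a * t) * (t * b - b * t) = 0 := fun a b => h2 _ (by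
    have e := h3 (a * b)
    have ea := h3 a
    have eb := h3 b
    calc _ = (t * (t * (a * b) - a * b * t) - (t * (a * b) - a * b * t) * t)
          - (t * (t * a - a * t) - (t * a - a * t) * t) * b
          - a * (t * (t * b - b * t) - (t * b - b * t) * t) := by noncomm_ring
      _ = 0 := by rw [e, ea, eb]; simp)
  rw [← sub_eq_zero]
  refine IsSemiprimeAlg.eq_zero _ fun b => ?_
  calc _ = (t * a - a * t) * (t * (b * a) - b * a * t) -
        (t * a - a * t) * (t * b - b * t) * a := by noncomm_ring
    _ = 0 := by rw [h4, h4]; simp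

/-- A skew element `y` for which `[y, [K, K]]` centralizes `K` centralizes `K`. -/
theorem commute_skew_of_commute_derived {R : Type*} [NonUnitalRing R] [StarRing R]
    [IsSemiprimeAlg R] (h2 : ∀ a : R, a + a = 0 → a = 0) {y : R} (hy : star y = -y)
    (h : ∀ a b c, star a = -a → star b = -b → star c = -c →
      (y * (a * b - b * a) - (a * b - b * a) * y) * c =
        c * (y * (a * b - b * a) - (a * b - b * a) * y))
    {k : R} (hk : star k = -k) : y * k = k * y := by
  -- First `(ad y)² k = 0`. The element `c = (ad y)² k` centralizes `K`, and so does `(ad y)²(y²k +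
  -- ky²) = y²c + cy²`; this gives `c³ = 0`, hence `c = 0`. The statement is kept general in `y`
  -- because it is also applied to `[y, k]`.
  have key : ∀ y : R, star y = -y → (∀ a b c, star a = -a → star b = -b → star c = -c →
      (y * (a * b - b * a) - (a * b - b * a) * y) * c =
        c * (y * (a * b - b * a) - (a * b - b * a) * y)) →
      ∀ k, star k = -k → y * (y * k - k * y) - (y * k - k * y) * y = 0 := by
    intro y hy h k hk
    have hv := star_commutator_eq_neg hy hk
    have hcK : ∀ a, star a = -a → (y * (y * k - k * y) - (y * k - k * y) * y) * a =
        a * (y * (y * k - k * y) - (y * k - k * y) * y) := fun a ha => h y k a hy hk ha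
    have hc := star_commutator_eq_neg hy hv
    have h3 := h y _ k hy (star_jordan_sq_eq_neg hy hk) hk
    have e : y * (y * (y * y * k + k * y * y) - (y * y * k + k * y * y) * y) -
        (y * (y * y * k + k * y * y) - (y * y * k + k * y * y) * y) * y =
        y * y * (y * (y * k - k * y) - (y * k - k * y) * y) +
        (y * (y * k - k * y) - (y * k - k * y) * y) * y * y := by noncomm_ring
    rw [e] at h3
    refine eq_zero_of_central_skew_of_cube h2 hc hcK ?_
    have h4 := mul_jordan_eq_zero_of_commute h2 rfl (hcK k hk) h3 (hcK y hy)
    refine cube_eq_zero_of_commutator h2 rfl (hcK y hy) (hcK _ hv) ?_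
    generalize hcd : y * (y * k - k * y) - (y * k - k * y) * y = c at *
    generalize y * k - k * y = v at *
    have hcy := hcK y hy
    have e5 : y * c + c * y = y * (y * v + v * y) - (y * v + v * y) * y := by
      rw [← hcd]; noncomm_ring
    rw [e5, mul_sub, ← mul_assoc c y, hcy, ← mul_assoc c _ y, h4, mul_assoc, h4]
    simp
  have hv := star_commutator_eq_neg hy hk
  have hyy := key y hy h
  -- The hypothesis passes to `v = [y, k]`: by Jacobi `[v, [a, b]] = [y, [k, [a, b]]] - [k, [y, [a,
  -- b]]]`, and the last term vanishes.
  have hvv := key _ hv fun a b c ha hb hc => by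
    have e : (y * k - k * y) * (a * b - b * a) - (a * b - b * a) * (y * k - k * y) =
        (y * (k * (a * b - b * a) - (a * b - b * a) * k) -
          (k * (a * b - b * a) - (a * b - b * a) * k) * y) := by
      have := h a b k ha hb hk
      rw [← sub_eq_zero] at this ⊢
      rw [← this]; noncomm_ring
    rw [e]
    exact h k _ c hk (star_commutator_eq_neg ha hb) hc
  have cy := sq_central_of_ad_sq h2 hy hyy
  have cv := sq_central_of_ad_sq h2 hv hvv
  have hyv : ∀ k, star k = -k → y * (y * k - k * y) = 0 := fun k hk => h2 _ (by
    have e1 := hyy k hk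
    have e2 := cy k
    rw [← sub_eq_zero] at e2
    calc _ = (y * (y * k - k * y) - (y * k - k * y) * y) + (y * y * k - k * (y * y)) := by
          noncomm_ring
      _ = 0 := by rw [e1, e2, add_zero])
  -- Testing `y[y, ·] = 0` on `k³` yields `v²k + vkv + kv² = 0`, because `yv = 0` and `ykv = v²`.
  have h3 := hyv _ (star_triple_eq_neg hk hk)
  have h1 := hyv k hk
  have hvyy := hyy k hk
  rw [← sub_eq_zero]
  generalize hv' : y * k - k * y = v at *
  have hyk : y * k = v + k * y := by rw [← hv']; abel
  have e1 : y * k * v = v * v := by rw [hyk, add_mul, mul_assoc, h1]; simp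
  have e2 : y * (y * (k * k * k) - k * k * k * y) =
      y * v * k * k + y * k * v * k + y * k * k * v := by rw [← hv']; noncomm_ring
  have e3 : y * k * k * v = v * k * v + k * (v * v) := by
    rw [hyk, add_mul, add_mul, ← e1]; noncomm_ring
  rw [e2, h1, e1, e3] at h3
  -- Multiplying that identity by `y` on the left leaves only `ykv² = v³`.
  have hv3 : v * v * v = 0 := by
    calc v * v * v = y * k * v * v := by rw [e1]
      _ = y * (0 * k * k + v * v * k + (v * k * v + k * (v * v))) -
          (y * v) * v * k - (y * v) * k * v := by noncomm_ring
      _ = 0 := by rw [h3, h1]; simp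
  have hv2 : v * v = 0 := eq_zero_of_central_of_sq cv (by rw [← mul_assoc, hv3, zero_mul])
  refine eq_zero_of_skew_sandwich h2 hv fun k hk => h2 _ ?_
  have := hvv k hk
  calc v * k * v + v * k * v = v * v * k + k * (v * v) -
        (v * (v * k - k * v) - (v * k - k * v) * v) := by noncomm_ring
    _ = 0 := by rw [this, hv2]; simp

end SemiprimeInvolution

/-! ### Rings with a family of dense subrings -/

section DenseFamily

variable {Φ R : Type*} [CommRing Φ] [NonUnitalRing R] [StarRing R] [Module Φ R]

/-- A family of `*`-subalgebras of `R`, to be thought of as the essential `*`-ideals of a ring of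
which `R` is a ring of quotients. -/
structure IsDenseFamily (F : Set (NonUnitalStarSubalgebra Φ R)) : Prop where
  exists_le : ∀ J ∈ F, ∀ q : R, ∃ J' ∈ F, J' ≤ J ∧ ∀ j ∈ J', q * j ∈ J ∧ j * q ∈ J
  eq_zero : ∀ J ∈ F, ∀ q : R, (∀ j ∈ J, q * j * q = 0) → q = 0

namespace IsDenseFamily

variable {F : Set (NonUnitalStarSubalgebra Φ R)} (hF : IsDenseFamily F)
  (h2 : ∀ a : R, a + a = 0 → a = 0) {J : NonUnitalStarSubalgebra Φ R} (hJ : J ∈ F)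

include hF hJ

theorem isSemiprimeAlg : IsSemiprimeAlg R := ⟨fun a h => hF.eq_zero J hJ a fun j _ => h j⟩

theorem isSemiprimeAlg_mem : IsSemiprimeAlg J :=
  ⟨fun a h => Subtype.ext (hF.eq_zero J hJ a fun j hj => congrArg Subtype.val (h ⟨j, hj⟩))⟩

include h2

omit hF hJ in
theorem eq_zero_on_of_symm_of_skew (f : R →+ R) (hs : ∀ s ∈ J, star s = s → f s = 0)
    (hk : ∀ k ∈ J, star k = -k → f k = 0) {a : R} (ha : a ∈ J) : f a = 0 := by
  refine h2 _ ?_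
  rw [← map_add, show a + a = (a + star a) + (a - star a) by abel, map_add,
    hs _ (add_mem ha (star_mem ha)) (star_add_star_self a),
    hk _ (sub_mem ha (star_mem ha)) (star_sub_star_self a), add_zero]

/-- Linearizing `wx² = 0` upgrades it to `wx = 0 = xw` for all skew `x` in `J`. On a smaller `J'`
with `wJ'` and `J'w` inside `J`, the skew elements `ws + sw` are then killed by `w` as well, which
leads to `w²J' = 0` and `wJ'w = 0`. -/
theorem eq_zero_of_commute_of_mul_sq {w : R} (hw : star w = -w)
    (hc : ∀ x ∈ J, star x = -x → w * x = x * w) (h0 : ∀ x ∈ J, star x = -x → w * x * x = 0) :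
    w = 0 := by
  have h1 : ∀ x ∈ J, ∀ y ∈ J, star x = -x → star y = -y → w * x * y = -(w * y * x) := by
    intro x hx y hy hx' hy'
    have e := h0 (x + y) (add_mem hx hy) (by rw [star_add, hx', hy', neg_add])
    have ex := h0 x hx hx'
    have ey := h0 y hy hy'
    rw [eq_neg_iff_add_eq_zero]
    calc _ = w * (x + y) * (x + y) - w * x * x - w * y * y := by noncomm_ring
      _ = 0 := by rw [e, ex, ey]; simp
  have hwx : ∀ x ∈ J, star x = -x → w * x = 0 := by
    intro x hx hx'
    have hcx := hc x hx hx'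
    have hx0 := h0 x hx hx'
    have hxxw : x * x * w = 0 := by rw [mul_assoc, ← hcx, ← mul_assoc, ← hcx, hx0]
    refine hF.eq_zero J hJ _ fun j hj => eq_zero_on_of_symm_of_skew h2
      ((AddMonoidHom.mulRight (w * x)).comp (AddMonoidHom.mulLeft (w * x))) ?_ ?_ hj
    · intro s hs hs'
      change w * x * s * (w * x) = 0
      -- Anticommuting `x` with the skew element `xs + sx` produces `2wxsx` plus terms containing
      -- `wx²` or, after right multiplication by `w`, `x²w`.
      have ht := h1 x hx (x * s + s * x) (add_mem (mul_mem hx hs) (mul_mem hs hx)) hx'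
        (star_jordan_eq_neg hx' hs')
      rw [eq_neg_iff_add_eq_zero] at ht
      rw [show w * x * s * (w * x) = w * x * s * (x * w) from congrArg (w * x * s * ·) hcx]
      refine h2 _ ?_
      calc _ = (w * x * (x * s + s * x) + w * (x * s + s * x) * x) * w - w * x * x * s * w
            - w * s * (x * x * w) := by noncomm_ring
        _ = 0 := by rw [ht, hx0, hxxw]; simp
    · intro k hk hk'
      change w * x * k * (w * x) = 0
      rw [h1 x hx k hk hx' hk', hcx, neg_mul, mul_assoc _ x, ← mul_assoc x, hxxw, mul_zero,
        neg_zero]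
  have hxw : ∀ x ∈ J, star x = -x → x * w = 0 := fun x hx hx' => by
    rw [← hc x hx hx', hwx x hx hx']
  obtain ⟨J', hJ', hle, hJw⟩ := hF.exists_le J hJ w
  have hA : ∀ a ∈ J', w * (w * a + a * w) = 0 := fun a ha =>
    eq_zero_on_of_symm_of_skew h2 ((AddMonoidHom.mulLeft w).comp
      (AddMonoidHom.mulLeft w + AddMonoidHom.mulRight w))
      (fun s hs hs' => hwx _ (add_mem (hJw s hs).1 (hJw s hs).2) (star_jordan_eq_neg hw hs'))
      (fun k hk hk' => by
        change w * (w * k + k * w) = 0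
        rw [hwx k (hle hk) hk', hxw k (hle hk) hk', add_zero, mul_zero]) ha
  have hB : ∀ k ∈ J, star k = -k → ∀ a ∈ J, w * a * k = 0 := fun k hk hk' a ha =>
    eq_zero_on_of_symm_of_skew h2 ((AddMonoidHom.mulRight k).comp (AddMonoidHom.mulLeft w))
      (fun s hs hs' => by
        change w * s * k = 0
        have := hwx _ (add_mem (mul_mem hk hs) (mul_mem hs hk)) (star_jordan_eq_neg hk' hs')
        rwa [mul_add, ← mul_assoc, hwx k hk hk', zero_mul, zero_add, ← mul_assoc] at this)
      (fun l hl hl' => by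
        change w * l * k = 0
        rw [hwx l hl hl', zero_mul]) ha
  have hC : ∀ a ∈ J, ∀ b ∈ J', w * a * (w * b + b * w) = 0 := fun a ha b hb =>
    eq_zero_on_of_symm_of_skew h2 ((AddMonoidHom.mulLeft (w * a)).comp
      (AddMonoidHom.mulLeft w + AddMonoidHom.mulRight w))
      (fun s hs hs' => hB _ (add_mem (hJw s hs).1 (hJw s hs).2) (star_jordan_eq_neg hw hs') a ha)
      (fun k hk hk' => by
        change w * a * (w * k + k * w) = 0
        rw [hwx k (hle hk) hk', hxw k (hle hk) hk', add_zero, mul_zero]) hb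
  have hD : ∀ a ∈ J', ∀ b ∈ J', w * w * a * b = 0 := fun a ha b hb => h2 _ (by
    calc _ = w * (w * (a * b) + (a * b) * w) - w * a * (w * b + b * w) +
          w * (w * a + a * w) * b := by noncomm_ring
      _ = 0 := by rw [hA a ha, hA _ (mul_mem ha hb), hC a (hle ha) b hb]; simp)
  have hE : ∀ a ∈ J', w * w * a = 0 := fun a ha => hF.eq_zero J' hJ' _ fun j hj => by
    rw [hD a ha j hj, zero_mul]
  refine hF.eq_zero J' hJ' w fun j hj => ?_
  calc w * j * w = w * (w * j + j * w) - w * w * j := by noncomm_ring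
    _ = 0 := by rw [hA j hj, hE j hj, sub_zero]

/-- For `w = [p, q]` and skew `x` in a small `J'`, both `[q, x]` and `xqx` are skew elements of `J`.
Commuting `p` with the first gives `[w, x] = 0`, with the second `xwx = 0`, so `wx² = 0`. -/
theorem commute_skew_of_commute_skew_mem {p : R} (hp : star p = -p)
    (h : ∀ x ∈ J, star x = -x → p * x = x * p) {q : R} (hq : star q = -q) : p * q = q * p := by
  obtain ⟨J', hJ', hle, hJq⟩ := hF.exists_le J hJ q
  have hpx : ∀ x ∈ J', star x = -x → p * x = x * p := fun x hx hx' => h x (hle hx) hx'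
  have hpq : ∀ x ∈ J', star x = -x → p * (q * x - x * q) = (q * x - x * q) * p :=
    fun x hx hx' => h _ (sub_mem (hJq x hx).1 (hJq x hx).2) (star_commutator_eq_neg hq hx')
  have hw : ∀ x ∈ J', star x = -x → (p * q - q * p) * x = x * (p * q - q * p) := by
    intro x hx hx'
    have e := sub_eq_zero.2 (hpq x hx hx')
    have e' := sub_eq_zero.2 (hpx x hx hx')
    rw [← sub_eq_zero]
    calc _ = (p * (q * x - x * q) - (q * x - x * q) * p) - q * (p * x - x * p) +
          (p * x - x * p) * q := by noncomm_ring
      _ = 0 := by rw [e, e']; simp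
  rw [← sub_eq_zero]
  refine hF.eq_zero_of_commute_of_mul_sq h2 hJ' (star_commutator_eq_neg hp hq) hw ?_
  intro x hx hx'
  have e := sub_eq_zero.2 (h _ (mul_mem (hJq x hx).2 (hle hx)) (star_triple_eq_neg hx' hq))
  have e' := sub_eq_zero.2 (hpx x hx hx')
  rw [hw x hx hx']
  calc _ = (p * (x * q * x) - x * q * x * p) - (p * x - x * p) * q * x -
        x * q * (p * x - x * p) := by noncomm_ring
    _ = 0 := by rw [e, e']; simp

/-- If `[p, K_J]` centralizes `K_R` then `p` centralizes `K_R`. -/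
theorem commute_skew_of_commutator {p : R} (hp : star p = -p)
    (h : ∀ x ∈ J, star x = -x → ∀ k, star k = -k →
      (p * x - x * p) * k = k * (p * x - x * p)) {q : R} (hq : star q = -q) : p * q = q * p := by
  have := hF.isSemiprimeAlg hJ
  -- Two shrinkings are needed so that `p²x + xp²` lies in `J` for `x` in `J₂`.
  obtain ⟨J₁, hJ₁, hle₁, hJp₁⟩ := hF.exists_le J hJ p
  obtain ⟨J₂, hJ₂, hle₂, hJp₂⟩ := hF.exists_le J₁ hJ₁ p
  refine hF.commute_skew_of_commute_skew_mem h2 hJ₂ hp (fun x hx hx' => ?_) hq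
  rw [← sub_eq_zero]
  have hc := h x (hle₁ (hle₂ hx)) hx'
  have h3 := h (p * p * x + x * p * p)
    (add_mem (by rw [mul_assoc]; exact (hJp₁ _ (hJp₂ x hx).1).1) (hJp₁ _ (hJp₂ x hx).2).2)
    (star_jordan_sq_eq_neg hp hx') x hx'
  have e : p * (p * p * x + x * p * p) - (p * p * x + x * p * p) * p =
      p * p * (p * x - x * p) + (p * x - x * p) * p * p := by noncomm_ring
  rw [e] at h3
  exact eq_zero_of_central_skew_of_cube h2 (star_commutator_eq_neg hp hx') hc
    (cube_eq_zero_of_commutator h2 rfl (hc p hp) (hc x hx')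
      (mul_jordan_eq_zero_of_commute h2 rfl (hc x hx') h3 (hc p hp)))

/-- If `[p, [K_J, K_J]]` centralizes `[K_R, K_R]` then `p` centralizes `K_R`. -/
theorem commute_skew_of_commutator_derived {p : R} (hp : star p = -p)
    (h : ∀ x ∈ J, ∀ y ∈ J, star x = -x → star y = -y → ∀ k l, star k = -k → star l = -l →
      (p * (x * y - y * x) - (x * y - y * x) * p) * (k * l - l * k) =
        (k * l - l * k) * (p * (x * y - y * x) - (x * y - y * x) * p))
    {q : R} (hq : star q = -q) : p * q = q * p := by
  have := hF.isSemiprimeAlg hJ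
  have := hF.isSemiprimeAlg_mem hJ
  have hw : ∀ x ∈ J, ∀ y ∈ J, star x = -x → star y = -y → ∀ k, star k = -k →
      (p * (x * y - y * x) - (x * y - y * x) * p) * k =
        k * (p * (x * y - y * x) - (x * y - y * x) * p) := by
    -- Here `[p, [x, y]]` centralizes `[K_R, K_R]`, hence `K_R`.
    intro x hx y hy hx' hy' k hk
    refine commute_skew_of_commute_derived h2
      (star_commutator_eq_neg hp (star_commutator_eq_neg hx' hy')) (fun a b c ha hb _ => ?_) hk
    rw [h x hx y hy hx' hy' a b ha hb, sub_self, zero_mul, mul_zero]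
  obtain ⟨J', hJ', hle, hJp⟩ := hF.exists_le J hJ p
  refine hF.commute_skew_of_commutator h2 hJ' hp (fun x hx hx' k hk => ?_) hq
  have hy := star_commutator_eq_neg hp hx'
  refine hF.commute_skew_of_commute_skew_mem h2 hJ hy (fun z hz hz' => ?_) hk
  -- Since `[p, x]` lies in `J`, the criterion can be applied inside the semiprime ring `J`, where
  -- only brackets of elements of `K_J` have to be tested.
  refine congrArg Subtype.val (commute_skew_of_commute_derived (R := J)
    (fun a ha => Subtype.ext (h2 _ (congrArg Subtype.val ha)))
    (y := ⟨_, sub_mem (hJp x hx).1 (hJp x hx).2⟩) (Subtype.ext hy) ?_ (k := ⟨z, hz⟩)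
    (Subtype.ext hz'))
  rintro ⟨a, ha⟩ ⟨b, hb⟩ ⟨c, hc⟩ ha' hb' hc'
  replace ha' : star a = -a := congrArg Subtype.val ha'
  replace hb' : star b = -b := congrArg Subtype.val hb'
  replace hc' : star c = -c := congrArg Subtype.val hc'
  refine Subtype.ext ?_
  change ((p * x - x * p) * (a * b - b * a) - (a * b - b * a) * (p * x - x * p)) * c =
    c * ((p * x - x * p) * (a * b - b * a) - (a * b - b * a) * (p * x - x * p))
  have hab := sub_mem (mul_mem ha hb) (mul_mem hb ha)
  have hab' := star_commutator_eq_neg ha' hb'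
  have e1 := hw x (hle hx) _ hab hx' hab' c hc'
  have e2 := sub_eq_zero.2 (hw a ha b hb ha' hb' x hx')
  -- Jacobi, with `[x, [p, [a, b]]] = 0` by `hw`; the remaining term has the form that `hw` handles.
  have e : (p * x - x * p) * (a * b - b * a) - (a * b - b * a) * (p * x - x * p) =
      (p * (x * (a * b - b * a) - (a * b - b * a) * x) -
        (x * (a * b - b * a) - (a * b - b * a) * x) * p) := by
    rw [← sub_eq_zero, ← e2]; noncomm_ring
  rw [e, e1]

end IsDenseFamily

end DenseFamily

/-! ### Essential ideals and the Martindale symmetric algebra of quotients -/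

namespace Martindale

variable {Φ A : Type*} [CommRing Φ] [NonUnitalRing A] [Module Φ A]
  [IsScalarTower Φ A A] [SMulCommClass Φ A A] [IsSemiprimeAlg A]
  [StarRing Φ] [TrivialStar Φ] [StarRing A] [StarModule Φ A]

omit [IsScalarTower Φ A A] [SMulCommClass Φ A A] [StarRing Φ] [TrivialStar Φ] [StarRing A]
  [StarModule Φ A] in
theorem IsDenseIdeal.eq_zero {J : Submodule Φ A} (hJ : IsDenseIdeal J) {a : A}
    (h : ∀ j ∈ J, a * j * a = 0) : a = 0 :=
  hJ.left_ann a fun j hj => IsSemiprimeAlg.eq_zero _ fun b => by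
    have := h _ (hJ.mul_right b j hj)
    rw [← mul_assoc, mul_assoc a, mul_assoc a] at this
    calc a * j * b * (a * j) = a * (j * b * a) * j := by simp only [mul_assoc]
      _ = 0 := by rw [mul_assoc j, ← mul_assoc j b a, this, zero_mul]

namespace Qs

theorem incl_injective : Function.Injective (incl Φ A) := by
  refine (injective_iff_map_eq_zero _).2 fun a ha => ?_
  have ha : mk (multPair a) = mk 0 := ha.trans (map_zero mk).symm
  obtain ⟨J, hJ, h⟩ := mk_eq_mk.1 ha
  exact hJ.left_ann a fun x hx => (h x hx).1

theorem mk_mul_incl {p : pairs Φ A} {J : Submodule Φ A} (hJ : IsDenseIdeal J)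
    (h : IsCompatiblePair J p.1.1 p.1.2) {x : A} (hx : x ∈ J) :
    mk p * incl Φ A x = incl Φ A (p.1.1 x) :=
  mk_eq_mk.2 ⟨J, hJ, fun y hy => ⟨h.f_mul x hx y, (h.compat y hy x hx).symm⟩⟩

theorem incl_mul_mk {p : pairs Φ A} {J : Submodule Φ A} (hJ : IsDenseIdeal J)
    (h : IsCompatiblePair J p.1.1 p.1.2) {x : A} (hx : x ∈ J) :
    incl Φ A x * mk p = incl Φ A (p.1.2 x) :=
  mk_eq_mk.2 ⟨J, hJ, fun y hy => ⟨h.compat x hx y hy, h.g_mul x hx y⟩⟩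

theorem eq_zero_of_mul_incl {q : Qs Φ A} {K : Submodule Φ A} (hK : IsDenseIdeal K)
    (h : ∀ k ∈ K, q * incl Φ A k = 0) (h' : ∀ k ∈ K, incl Φ A k * q = 0) : q = 0 := by
  obtain ⟨p, rfl⟩ := mk_surjective q
  obtain ⟨J, hJ, hp⟩ := p.2
  rw [← map_zero mk, mk_eq_mk]
  refine ⟨J ⊓ K, hJ.inf hK, fun x hx => ⟨?_, ?_⟩⟩
  · refine incl_injective (Φ := Φ) ?_
    rw [← mk_mul_incl hJ hp hx.1, h x hx.2]
    exact (map_zero _).symm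
  · refine incl_injective (Φ := Φ) ?_
    rw [← incl_mul_mk hJ hp hx.1, h' x hx.2]
    exact (map_zero _).symm

theorem exists_mul_incl (q : Qs Φ A) {I : Submodule Φ A} (hI : IsDenseIdeal I) :
    ∃ K : Submodule Φ A, IsDenseIdeal K ∧ K ≤ I ∧ ∀ k ∈ K,
      (∃ a ∈ I, q * incl Φ A k = incl Φ A a) ∧ ∃ a ∈ I, incl Φ A k * q = incl Φ A a := by
  obtain ⟨p, rfl⟩ := mk_surjective q
  obtain ⟨J, hJ, hp⟩ := p.2
  obtain ⟨K, hK, hKI, hKJ, hf, hg⟩ := exists_dense hJ hp hI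
  exact ⟨K, hK, hKI, fun k hk => ⟨⟨_, hf k hk, mk_mul_incl hJ hp (hKJ hk)⟩,
    ⟨_, hg k hk, incl_mul_mk hJ hp (hKJ hk)⟩⟩⟩

/-- For `k` in a dense ideal with `qk = a` in `A`, one has `aja = q(kj)qk = 0` for all `j` in `I`,
so `a = 0`; symmetrically for `kq`. -/
theorem eq_zero_of_mul_incl_mul {q : Qs Φ A} {I : Submodule Φ A} (hI : IsDenseIdeal I)
    (h : ∀ j ∈ I, q * incl Φ A j * q = 0) : q = 0 := by
  obtain ⟨K, hK, hKI, hKq⟩ := exists_mul_incl q hI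
  refine eq_zero_of_mul_incl hK (fun k hk => ?_) (fun k hk => ?_)
  · obtain ⟨a, -, ha⟩ := (hKq k hk).1
    have : a = 0 := hI.eq_zero fun j hj => incl_injective (Φ := Φ) (by
      have := h _ (hI.mul_left k j hj)
      rw [map_mul, map_mul, map_zero, ← ha]
      rw [map_mul] at this
      calc _ = q * (incl Φ A k * incl Φ A j) * q * incl Φ A k := by simp only [mul_assoc]
        _ = 0 := by rw [this, zero_mul])
    rw [ha, this, map_zero]
  · obtain ⟨a, -, ha⟩ := (hKq k hk).2
    have : a = 0 := hI.eq_zero fun j hj => incl_injective (Φ := Φ) (by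
      have := h _ (hI.mul_right k j hj)
      rw [map_mul, map_mul, map_zero, ← ha]
      rw [map_mul] at this
      calc _ = incl Φ A k * (q * (incl Φ A j * incl Φ A k) * q) := by simp only [mul_assoc]
        _ = 0 := by rw [this, mul_zero])
    rw [ha, this, map_zero]

theorem eq_zero_of_add_self (h2 : ∀ a : A, a + a = 0 → a = 0) (q : Qs Φ A) (h : q + q = 0) :
    q = 0 := by
  obtain ⟨K, hK, -, hKq⟩ := exists_mul_incl q (isDenseIdeal_top (Φ := Φ) (A := A))
  refine eq_zero_of_mul_incl hK (fun k hk => ?_) (fun k hk => ?_)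
  · obtain ⟨a, -, ha⟩ := (hKq k hk).1
    have : a = 0 := h2 a (incl_injective (Φ := Φ) (by
      rw [map_add, ← ha, ← add_mul, h, zero_mul, map_zero]))
    rw [ha, this, map_zero]
  · obtain ⟨a, -, ha⟩ := (hKq k hk).2
    have : a = 0 := h2 a (incl_injective (Φ := Φ) (by
      rw [map_add, ← ha, ← mul_add, h, mul_zero, map_zero]))
    rw [ha, this, map_zero]

variable (Q : NonUnitalStarSubalgebra Φ (Qs Φ A)) (hAQ : ∀ a, incl Φ A a ∈ Q)

/-- The canonical embedding of `A` into a subalgebra `Q` of `Q_s(A)` that contains `A`. -/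
def inclSub : A →⋆ₙₐ[Φ] Q := NonUnitalStarAlgHom.codRestrict (incl Φ A) Q hAQ

theorem inclSub_injective : Function.Injective (inclSub Q hAQ) := fun _ _ h =>
  incl_injective (congrArg Subtype.val h)

/-- The images in `Q` of the essential `*`-ideals of `A`. -/
def denseFamily : Set (NonUnitalStarSubalgebra Φ Q) :=
  {J | ∃ I : Submodule Φ A, IsDenseIdeal I ∧ ∀ q, q ∈ J ↔ ∃ a ∈ I, inclSub Q hAQ a = q}

theorem exists_mem_denseFamily {I : Submodule Φ A} (hI : IsDenseIdeal I)
    (hstar : ∀ a ∈ I, star a ∈ I) :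
    ∃ J ∈ denseFamily Q hAQ, ∀ q, q ∈ J ↔ ∃ a ∈ I, inclSub Q hAQ a = q := by
  let J : NonUnitalStarSubalgebra Φ Q :=
    { carrier := {q | ∃ a ∈ I, inclSub Q hAQ a = q}
      add_mem' := by
        rintro _ _ ⟨a, ha, rfl⟩ ⟨b, hb, rfl⟩
        exact ⟨a + b, I.add_mem ha hb, map_add _ _ _⟩
      zero_mem' := ⟨0, I.zero_mem, map_zero _⟩
      mul_mem' := by
        rintro _ _ ⟨a, ha, rfl⟩ ⟨b, hb, rfl⟩
        exact ⟨a * b, hI.mul_left _ _ hb, map_mul _ _ _⟩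
      smul_mem' := by
        rintro c _ ⟨a, ha, rfl⟩
        exact ⟨c • a, I.smul_mem c ha, map_smul _ _ _⟩
      star_mem' := by
        rintro _ ⟨a, ha, rfl⟩
        exact ⟨star a, hstar a ha, map_star _ _⟩ }
  exact ⟨J, ⟨I, hI, fun q => Iff.rfl⟩, fun q => Iff.rfl⟩

theorem isDenseFamily : IsDenseFamily (denseFamily Q hAQ) where
  exists_le := by
    rintro J ⟨I, hI, hJ⟩ q
    obtain ⟨K, hK, hKI, hKq⟩ := exists_mul_incl (q : Qs Φ A) hI
    obtain ⟨K', hK', hKK'⟩ := hK.exists_star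
    obtain ⟨J', hJ', hmem⟩ := exists_mem_denseFamily Q hAQ (hK.inf hK') fun a ha =>
      ⟨(hKK' a).1 ha.2, (hKK' _).2 (by rw [star_star]; exact ha.1)⟩
    refine ⟨J', hJ', fun x hx => ?_, fun x hx => ?_⟩
    · obtain ⟨a, ha, rfl⟩ := (hmem x).1 hx
      exact (hJ _).2 ⟨a, hKI ha.1, rfl⟩
    · obtain ⟨a, ha, rfl⟩ := (hmem x).1 hx
      obtain ⟨⟨b, hb, h⟩, c, hc, h'⟩ := hKq a ha.1
      exact ⟨(hJ _).2 ⟨b, hb, Subtype.ext h.symm⟩, (hJ _).2 ⟨c, hc, Subtype.ext h'.symm⟩⟩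
  eq_zero := by
    rintro J ⟨I, hI, hJ⟩ q h
    exact Subtype.ext (eq_zero_of_mul_incl_mul hI fun j hj =>
      congrArg Subtype.val (h _ ((hJ _).2 ⟨j, hj, rfl⟩)))

/-- The largest ideal `I` of `A` with `I q ⊆ A` and `q I ⊆ A`. -/
def absorbIdeal (q : Q) : Submodule Φ A where
  carrier := {a | inclSub Q hAQ a * q ∈ (inclSub Q hAQ : A →ₗ[Φ] Q).range ∧
    q * inclSub Q hAQ a ∈ (inclSub Q hAQ : A →ₗ[Φ] Q).range ∧
    ∀ b, inclSub Q hAQ (a * b) * q ∈ (inclSub Q hAQ : A →ₗ[Φ] Q).range ∧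
      q * inclSub Q hAQ (b * a) ∈ (inclSub Q hAQ : A →ₗ[Φ] Q).range}
  add_mem' := by
    rintro a a' ⟨h1, h2, h3⟩ ⟨h1', h2', h3'⟩
    refine ⟨?_, ?_, fun b => ⟨?_, ?_⟩⟩
    · rw [map_add, add_mul]; exact add_mem h1 h1'
    · rw [map_add, mul_add]; exact add_mem h2 h2'
    · rw [add_mul, map_add, add_mul]; exact add_mem (h3 b).1 (h3' b).1
    · rw [mul_add, map_add, mul_add]; exact add_mem (h3 b).2 (h3' b).2
  zero_mem' := by
    refine ⟨?_, ?_, fun b => ⟨?_, ?_⟩⟩ <;> simp only [map_zero, zero_mul, mul_zero, zero_mem]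
  smul_mem' := by
    rintro c a ⟨h1, h2, h3⟩
    refine ⟨?_, ?_, fun b => ⟨?_, ?_⟩⟩
    · rw [map_smul, smul_mul_assoc]; exact Submodule.smul_mem _ c h1
    · rw [map_smul, mul_smul_comm]; exact Submodule.smul_mem _ c h2
    · rw [smul_mul_assoc, map_smul, smul_mul_assoc]; exact Submodule.smul_mem _ c (h3 b).1
    · rw [mul_smul_comm, map_smul, mul_smul_comm]; exact Submodule.smul_mem _ c (h3 b).2

theorem inclSub_mul_mem_range (a : A) {x : Q} (hx : x ∈ (inclSub Q hAQ : A →ₗ[Φ] Q).range) :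
    inclSub Q hAQ a * x ∈ (inclSub Q hAQ : A →ₗ[Φ] Q).range := by
  obtain ⟨b, rfl⟩ := hx
  exact ⟨a * b, map_mul (inclSub Q hAQ) a b⟩

theorem mul_inclSub_mem_range (a : A) {x : Q} (hx : x ∈ (inclSub Q hAQ : A →ₗ[Φ] Q).range) :
    x * inclSub Q hAQ a ∈ (inclSub Q hAQ : A →ₗ[Φ] Q).range := by
  obtain ⟨b, rfl⟩ := hx
  exact ⟨b * a, map_mul (inclSub Q hAQ) b a⟩

theorem star_mem_range {x : Q} (hx : x ∈ (inclSub Q hAQ : A →ₗ[Φ] Q).range) :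
    star x ∈ (inclSub Q hAQ : A →ₗ[Φ] Q).range := by
  obtain ⟨b, rfl⟩ := hx
  exact ⟨star b, map_star (inclSub Q hAQ) b⟩

/-- It contains any dense ideal absorbed by `q`. Such an ideal need not be graded or `*`-stable; the
largest one, being canonical, inherits the symmetries of `q`. -/
theorem isDenseIdeal_absorbIdeal (q : Q) : IsDenseIdeal (absorbIdeal Q hAQ q) := by
  obtain ⟨K, hK, -, hKq⟩ := exists_mul_incl (q : Qs Φ A) (isDenseIdeal_top (Φ := Φ) (A := A))
  have hl : ∀ k ∈ K, inclSub Q hAQ k * q ∈ (inclSub Q hAQ : A →ₗ[Φ] Q).range := fun k hk => by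
    obtain ⟨-, c, -, h⟩ := hKq k hk
    exact ⟨c, Subtype.ext h.symm⟩
  have hr : ∀ k ∈ K, q * inclSub Q hAQ k ∈ (inclSub Q hAQ : A →ₗ[Φ] Q).range := fun k hk => by
    obtain ⟨⟨c, -, h⟩, -⟩ := hKq k hk
    exact ⟨c, Subtype.ext h.symm⟩
  have hle : K ≤ absorbIdeal Q hAQ q := fun k hk =>
    ⟨hl k hk, hr k hk, fun b => ⟨hl _ (hK.mul_right b k hk), hr _ (hK.mul_left b k hk)⟩⟩
  refine ⟨?_, ?_, fun a ha => hK.left_ann a fun x hx => ha x (hle hx),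
    fun a ha => hK.right_ann a fun x hx => ha x (hle hx)⟩
  · rintro c a ⟨h1, h2, h3⟩
    refine ⟨?_, (h3 c).2, fun b => ⟨?_, ?_⟩⟩
    · rw [map_mul, mul_assoc]; exact inclSub_mul_mem_range Q hAQ c h1
    · rw [mul_assoc, map_mul, mul_assoc]; exact inclSub_mul_mem_range Q hAQ c (h3 b).1
    · rw [← mul_assoc]; exact (h3 _).2
  · rintro c a ⟨h1, h2, h3⟩
    refine ⟨(h3 c).1, ?_, fun b => ⟨?_, ?_⟩⟩
    · rw [map_mul, ← mul_assoc]; exact mul_inclSub_mem_range Q hAQ c h2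
    · rw [mul_assoc]; exact (h3 _).1
    · rw [← mul_assoc, map_mul, ← mul_assoc]; exact mul_inclSub_mem_range Q hAQ c (h3 b).2

theorem star_mem_absorbIdeal {q : Q} (hq : star q = -q) {a : A}
    (ha : a ∈ absorbIdeal Q hAQ q) : star a ∈ absorbIdeal Q hAQ q := by
  have hl : ∀ a, inclSub Q hAQ a * q ∈ (inclSub Q hAQ : A →ₗ[Φ] Q).range →
      q * inclSub Q hAQ (star a) ∈ (inclSub Q hAQ : A →ₗ[Φ] Q).range := fun a ha => by
    have h := star_mem_range Q hAQ ha
    rw [star_mul, hq, ← map_star] at h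
    exact neg_mem_iff.1 ((neg_mul q (inclSub Q hAQ (star a))).symm ▸ h)
  have hr : ∀ a, q * inclSub Q hAQ a ∈ (inclSub Q hAQ : A →ₗ[Φ] Q).range →
      inclSub Q hAQ (star a) * q ∈ (inclSub Q hAQ : A →ₗ[Φ] Q).range := fun a ha => by
    have h := star_mem_range Q hAQ ha
    rw [star_mul, hq, ← map_star] at h
    exact neg_mem_iff.1 ((mul_neg (inclSub Q hAQ (star a)) q).symm ▸ h)
  obtain ⟨h1, h2, h3⟩ := ha
  refine ⟨hr _ h2, hl _ h1, fun b => ⟨?_, ?_⟩⟩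
  · rw [show star a * b = star (star b * a) by simp]; exact hr _ (h3 _).2
  · rw [show b * star a = star (a * star b) by simp]; exact hl _ (h3 _).1

/-- The elements `y` of `Q` with `I y ⊆ A` and `y I ⊆ A`. -/
def absorbed (I : Submodule Φ A) : Submodule Φ Q where
  carrier := {y | ∀ a ∈ I, inclSub Q hAQ a * y ∈ (inclSub Q hAQ : A →ₗ[Φ] Q).range ∧
    y * inclSub Q hAQ a ∈ (inclSub Q hAQ : A →ₗ[Φ] Q).range}
  add_mem' := fun hx hy a ha => ⟨by rw [mul_add]; exact add_mem (hx a ha).1 (hy a ha).1,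
    by rw [add_mul]; exact add_mem (hx a ha).2 (hy a ha).2⟩
  zero_mem' := fun a ha => by simp
  smul_mem' := fun c x hx a ha => ⟨by rw [mul_smul_comm]; exact Submodule.smul_mem _ c (hx a ha).1,
    by rw [smul_mul_assoc]; exact Submodule.smul_mem _ c (hx a ha).2⟩

/-- Because `I` is a two-sided ideal, `b[a, y] = (ba)y - (by)a` stays in `A`. This controls all
iterated brackets of `q` with `A` at once. -/
theorem commutator_mem_absorbed {I : Submodule Φ A} (hI : IsDenseIdeal I) (a : A) {y : Q}
    (hy : y ∈ absorbed Q hAQ I) :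
    inclSub Q hAQ a * y - y * inclSub Q hAQ a ∈ absorbed Q hAQ I := by
  refine fun b hb => ⟨?_, ?_⟩
  · rw [mul_sub, ← mul_assoc, ← map_mul, ← mul_assoc]
    exact sub_mem (hy _ (hI.mul_right a b hb)).1 (mul_inclSub_mem_range Q hAQ a (hy b hb).1)
  · rw [sub_mul, mul_assoc, mul_assoc, ← map_mul]
    exact sub_mem (inclSub_mul_mem_range Q hAQ a (hy b hb).2) (hy _ (hI.mul_left a b hb)).2

end Qs

end Martindale

/-! ### Projections of a grading -/

section GradingProj

variable {Φ G V W : Type*} [CommRing Φ] [AddCommGroup V] [Module Φ V] [AddCommGroup W] [Module Φ W]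

/-- `π` is the family of projections onto the components of a grading `ℒ`. -/
structure IsGradingProj (ℒ : G → Submodule Φ V) (π : G → V →ₗ[Φ] V) : Prop where
  mem : ∀ σ x, π σ x ∈ ℒ σ
  same : ∀ σ, ∀ x ∈ ℒ σ, π σ x = x
  other : ∀ σ τ, τ ≠ σ → ∀ x ∈ ℒ τ, π σ x = 0
  sum : ∀ x, ∃ s : Finset G, ∑ σ ∈ s, π σ x = x

theorem DirectSum.IsInternal.exists_isGradingProj [DecidableEq G] {ℒ : G → Submodule Φ V}
    (h : DirectSum.IsInternal ℒ) : ∃ π, IsGradingProj ℒ π := by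
  classical
  let _ := h.chooseDecomposition
  refine ⟨fun σ => (ℒ σ).subtype ∘ₗ DirectSum.component Φ G (fun i => ℒ i) σ ∘ₗ
    (DirectSum.decomposeLinearEquiv ℒ).toLinearMap, fun σ x => ?_, fun σ x hx => ?_,
    fun σ τ hτ x hx => ?_, fun x => ⟨_, DirectSum.sum_support_decompose ℒ x⟩⟩
  · exact (DirectSum.decompose ℒ x σ).2
  · exact DirectSum.decompose_of_mem_same ℒ hx
  · exact DirectSum.decompose_of_mem_ne ℒ hx hτ

namespace IsGradingProj

variable {ℒ : G → Submodule Φ V} {π : G → V →ₗ[Φ] V} {ℳ : G → Submodule Φ W}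
  {ρ : G → W →ₗ[Φ] W}

theorem isInternal [DecidableEq G] (h : IsGradingProj ℒ π) : DirectSum.IsInternal ℒ := by
  rw [DirectSum.isInternal_submodule_iff_iSupIndep_and_iSup_eq_top]
  refine ⟨fun σ => ?_, ?_⟩
  · rw [Submodule.disjoint_def]
    intro x hx hx'
    have : (⨆ j, ⨆ (_ : j ≠ σ), ℒ j) ≤ LinearMap.ker (π σ) :=
      iSup₂_le fun τ hτ y hy => h.other σ τ hτ y hy
    rw [← h.same σ x hx]
    exact this hx'
  · refine eq_top_iff.2 fun x _ => ?_
    obtain ⟨s, hs⟩ := h.sum x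
    rw [← hs]
    exact sum_mem fun σ _ => Submodule.mem_iSup_of_mem σ (h.mem σ x)

/-- Additive maps that permute degrees commute with the projections. -/
theorem proj_map (h : IsGradingProj ℒ π) (h' : IsGradingProj ℳ ρ) (f : V →+ W) {g : G → G}
    (hg : Function.Injective g) (hf : ∀ σ, ∀ x ∈ ℒ σ, f x ∈ ℳ (g σ)) (σ : G) (x : V) :
    ρ (g σ) (f x) = f (π σ x) := by
  classical
  have key : ∀ τ, ∀ x ∈ ℒ τ, ρ (g σ) (f x) = f (π σ x) := fun τ x hx => by
    by_cases hτ : τ = σ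
    · subst hτ
      rw [h.same _ _ hx, h'.same _ _ (hf _ _ hx)]
    · rw [h.other _ _ hτ _ hx, h'.other _ _ (hg.ne hτ) _ (hf _ _ hx), map_zero]
  obtain ⟨s, hs⟩ := h.sum x
  rw [← hs, map_sum, map_sum, map_sum, map_sum]
  exact Finset.sum_congr rfl fun τ _ => key τ _ (h.mem τ x)

/-- For a graded submodule `N`, a linear condition need only be checked on homogeneous elements. -/
theorem sub_induction (h : IsGradingProj ℒ π) {N : Submodule Φ V} (hN : ∀ σ, ∀ x ∈ N, π σ x ∈ N)
    {P : Submodule Φ W} (f : V →ₗ[Φ] W) (hP : ∀ σ, ∀ x ∈ N, x ∈ ℒ σ → f x ∈ P) :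
    ∀ x ∈ N, f x ∈ P := fun x hx => by
  obtain ⟨s, hs⟩ := h.sum x
  rw [← hs, map_sum]
  exact sum_mem fun σ _ => hP σ _ (hN σ x hx) (h.mem σ x)

theorem comap (h : IsGradingProj ℒ π) {N : Submodule Φ V} (hN : ∀ σ, ∀ x ∈ N, π σ x ∈ N) :
    IsGradingProj (fun σ => (ℒ σ).comap N.subtype) (fun σ => (π σ).restrict (hN σ)) where
  mem σ x := h.mem σ x
  same σ x hx := Subtype.ext (h.same σ x hx)
  other σ τ hτ x hx := Subtype.ext (h.other σ τ hτ x hx)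
  sum x := by
    obtain ⟨s, hs⟩ := h.sum x
    exact ⟨s, Subtype.ext (by rw [AddSubmonoidClass.coe_finsetSum]; exact hs)⟩

theorem map_mkQ (h : IsGradingProj ℒ π) {N : Submodule Φ V} (hN : ∀ σ, ∀ x ∈ N, π σ x ∈ N) :
    IsGradingProj (fun σ => (ℒ σ).map N.mkQ) (fun σ => N.mapQ N (π σ) (hN σ)) where
  mem σ x := by
    obtain ⟨x, rfl⟩ := N.mkQ_surjective x
    exact ⟨_, h.mem σ x, rfl⟩
  same σ := by
    rintro _ ⟨x, hx, rfl⟩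
    exact congrArg N.mkQ (h.same σ x hx)
  other σ τ hτ := by
    rintro _ ⟨x, hx, rfl⟩
    exact (congrArg N.mkQ (h.other σ τ hτ x hx)).trans (map_zero _)
  sum x := by
    obtain ⟨x, rfl⟩ := N.mkQ_surjective x
    obtain ⟨s, hs⟩ := h.sum x
    exact ⟨s, by conv_rhs => rw [← hs, map_sum]
                 rfl⟩

end IsGradingProj

end GradingProj

/-! ### Centers and derived algebras of graded Lie algebras -/

section GradedLie

variable {Φ L M G : Type*} [CommRing Φ] [LieRing L] [LieAlgebra Φ L] [LieRing M] [LieAlgebra Φ M]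

theorem mem_center_iff {z : L} : z ∈ LieAlgebra.center Φ L ↔ ∀ x : L, ⁅x, z⁆ = 0 :=
  LieModule.mem_maxTrivSubmodule Φ L L z

theorem mem_center_iff' {z : L} : z ∈ LieAlgebra.center Φ L ↔ ∀ x : L, ⁅z, x⁆ = 0 := by
  rw [mem_center_iff]
  exact forall_congr' fun x => by rw [← lie_skew, neg_eq_zero]

theorem mem_Derived_iff {x : L} :
    x ∈ Derived Φ L ↔ x ∈ Submodule.span Φ {z : L | ∃ x y : L, ⁅x, y⁆ = z} := by
  rw [← LieSubmodule.mem_toSubmodule, LieSubmodule.lieIdeal_oper_eq_linear_span']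
  simp

theorem lie_mem_Derived (x y : L) : ⁅x, y⁆ ∈ Derived Φ L :=
  mem_Derived_iff.2 (Submodule.subset_span ⟨x, y, rfl⟩)

theorem modCenter_surjective : Function.Surjective (modCenter Φ L) :=
  (LieAlgebra.center Φ L).toSubmodule.mkQ_surjective

theorem modCenter_eq_zero_iff {x : L} : modCenter Φ L x = 0 ↔ x ∈ LieAlgebra.center Φ L :=
  Submodule.Quotient.mk_eq_zero _

variable [AddCommGroup G] {ℒ : G → Submodule Φ L} {π : G → L →ₗ[Φ] L}

theorem IsGradingProj.proj_lie (h : IsGradingProj ℒ π) [SetLike.GradedBracket ℒ] {σ τ : G}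
    (x : L) {y : L} (hy : y ∈ ℒ τ) : π (σ + τ) ⁅x, y⁆ = ⁅π σ x, y⁆ :=
  h.proj_map h (AddMonoidHom.mk' (fun x => ⁅x, y⁆) fun a b => add_lie a b y)
    (g := (· + τ)) (add_left_injective τ)
    (fun _ _ hx => SetLike.GradedBracket.bracket_mem hx hy) σ x

/-- For `y` of degree `τ`, `[z_σ, y]` is the component of `[z, y] = 0` in degree `σ + τ`. -/
theorem IsGradingProj.proj_mem_center (h : IsGradingProj ℒ π) [SetLike.GradedBracket ℒ] (σ : G)
    {z : L} (hz : z ∈ LieAlgebra.center Φ L) : π σ z ∈ LieAlgebra.center Φ L := by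
  rw [mem_center_iff'] at hz ⊢
  intro x
  obtain ⟨s, hs⟩ := h.sum x
  rw [← hs, lie_sum]
  exact Finset.sum_eq_zero fun τ _ => by rw [← h.proj_lie z (h.mem τ x), hz, map_zero]

omit [AddCommGroup G] in
/-- The brackets of homogeneous elements span the derived algebra. -/
theorem IsGradingProj.derived_induction (h : IsGradingProj ℒ π) {P : Submodule Φ L}
    (hP : ∀ σ τ, ∀ x ∈ ℒ σ, ∀ y ∈ ℒ τ, ⁅x, y⁆ ∈ P) {x : L} (hx : x ∈ Derived Φ L) : x ∈ P := by
  rw [mem_Derived_iff] at hx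
  refine Submodule.span_le.2 ?_ hx
  rintro _ ⟨x, y, rfl⟩
  obtain ⟨s, hs⟩ := h.sum x
  obtain ⟨t, ht⟩ := h.sum y
  rw [← hs, ← ht, sum_lie]
  refine sum_mem fun σ _ => ?_
  rw [lie_sum]
  exact sum_mem fun τ _ => hP _ _ _ (h.mem σ x) _ (h.mem τ y)

theorem IsGradingProj.proj_mem_derived (h : IsGradingProj ℒ π) [SetLike.GradedBracket ℒ] (σ : G)
    {x : L} (hx : x ∈ Derived Φ L) : π σ x ∈ Derived Φ L := by
  classical
  refine h.derived_induction (P := (Derived Φ L).toSubmodule.comap (π σ))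
    (fun ρ τ x hx y hy => ?_) hx
  have hxy := SetLike.GradedBracket.bracket_mem hx hy
  change π σ ⁅x, y⁆ ∈ Derived Φ L
  by_cases e : ρ + τ = σ
  · rw [h.same _ _ (e ▸ hxy)]; exact lie_mem_Derived x y
  · rw [h.other _ _ e _ hxy]; exact zero_mem _

theorem IsGradingProj.derivedGrading (h : IsGradingProj ℒ π) [SetLike.GradedBracket ℒ] :
    ∃ π', IsGradingProj (derivedGrading ℒ) π' :=
  ⟨_, h.comap (N := (Derived Φ L).toSubmodule) fun σ _ hx => h.proj_mem_derived σ hx⟩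

theorem IsGradingProj.modCenterGrading (h : IsGradingProj ℒ π) [SetLike.GradedBracket ℒ] :
    ∃ π', IsGradingProj (modCenterGrading ℒ) π' :=
  ⟨_, h.map_mkQ (N := (LieAlgebra.center Φ L).toSubmodule) fun σ _ hx => h.proj_mem_center σ hx⟩

instance [SetLike.GradedBracket ℒ] : SetLike.GradedBracket (derivedGrading ℒ) where
  bracket_mem _ _ _ _ hx hy := SetLike.GradedBracket.bracket_mem (ℒ := ℒ) hx hy

instance [SetLike.GradedBracket ℒ] : SetLike.GradedBracket (modCenterGrading ℒ) where
  bracket_mem := by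
    rintro i j _ _ ⟨x, hx, rfl⟩ ⟨y, hy, rfl⟩
    exact ⟨_, SetLike.GradedBracket.bracket_mem hx hy, LieHom.map_lie _ x y⟩

theorem derivedMap_injective {f : L →ₗ⁅Φ⁆ M} (hf : Function.Injective f) :
    Function.Injective (derivedMap f) := fun _ _ h =>
  Subtype.ext (hf (congrArg Subtype.val h))

/-- The homomorphism `L / Z_L → M / Z_M` induced by a homomorphism `L → M` that maps `Z_L` to
`Z_M`. -/
def modCenterMap (f : L →ₗ⁅Φ⁆ M)
    (hZ : ∀ z ∈ LieAlgebra.center Φ L, f z ∈ LieAlgebra.center Φ M) :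
    ModCenter Φ L →ₗ⁅Φ⁆ ModCenter Φ M where
  toLinearMap := Submodule.mapQ _ _ (f : L →ₗ[Φ] M) hZ
  map_lie' {x y} := by
    obtain ⟨x, rfl⟩ := modCenter_surjective x
    obtain ⟨y, rfl⟩ := modCenter_surjective y
    exact congrArg (modCenter Φ M) (LieHom.map_lie f x y)

theorem modCenterMap_apply (f : L →ₗ⁅Φ⁆ M)
    (hZ : ∀ z ∈ LieAlgebra.center Φ L, f z ∈ LieAlgebra.center Φ M) (x : L) :
    modCenterMap f hZ (modCenter Φ L x) = modCenter Φ M (f x) := rfl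

/-- Lifts the absorption condition from the quotients to `L` and `M`: nonzero becomes noncentral,
and the span of iterated brackets is replaced by any `L`-invariant submodule `Y` containing `q`. -/
theorem isGradedAlgebraOfQuotients_modCenterMap [DecidableEq G] {f : L →ₗ⁅Φ⁆ M}
    (hZ : ∀ z ∈ LieAlgebra.center Φ L, f z ∈ LieAlgebra.center Φ M)
    {ℳ : G → Submodule Φ M} {ρ : G → M →ₗ[Φ] M}
    [SetLike.GradedBracket ℒ] [SetLike.GradedBracket ℳ]
    (hℒ : IsGradingProj ℒ π) (hℳ : IsGradingProj ℳ ρ)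
    (hf : Function.Injective f) (hmap : ∀ σ, ∀ x ∈ ℒ σ, f x ∈ ℳ σ)
    (habs : ∀ p, p ∉ LieAlgebra.center Φ M → ∀ τ, ∀ q ∈ ℳ τ,
      ∃ α, ∃ x ∈ ℒ α, ⁅f x, p⁆ ∉ LieAlgebra.center Φ M ∧ ∃ Y : Submodule Φ M, q ∈ Y ∧
        (∀ l, ∀ y ∈ Y, ⁅f l, y⁆ ∈ Y) ∧ ∀ y ∈ Y, ⁅f x, y⁆ ∈ f.range) :
    IsGradedAlgebraOfQuotients (modCenterMap f hZ) (modCenterGrading ℒ)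
      (modCenterGrading ℳ) where
  isInternal_sub := hℒ.modCenterGrading.elim fun _ h => h.isInternal
  gradedBracket_sub := inferInstance
  isInternal := hℳ.modCenterGrading.elim fun _ h => h.isInternal
  gradedBracket := inferInstance
  injective := by
    refine (injective_iff_map_eq_zero _).2 fun x hx => ?_
    obtain ⟨x, rfl⟩ := modCenter_surjective x
    rw [modCenterMap_apply, modCenter_eq_zero_iff, mem_center_iff] at hx
    rw [modCenter_eq_zero_iff, mem_center_iff]
    exact fun y => hf (by rw [LieHom.map_lie, hx, map_zero])
  map_mem σ := by
    rintro _ ⟨x, hx, rfl⟩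
    exact ⟨f x, hmap σ x hx, rfl⟩
  absorb := by
    rintro σ τ _ ⟨p, hp, rfl⟩ hp0 _ ⟨q, hq, rfl⟩
    obtain ⟨α, x, hx, hxp, Y, hqY, hY, hxY⟩ :=
      habs p (fun h => hp0 (modCenter_eq_zero_iff.2 h)) τ q hq
    refine ⟨α, modCenter Φ L x, ⟨x, hx, rfl⟩, fun h => hxp (modCenter_eq_zero_iff.1 h), ?_⟩
    have hle : adSpan (modCenterMap f hZ) (modCenter Φ M q) ≤
        Y.map (modCenter Φ M : M →ₗ[Φ] ModCenter Φ M) := by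
      refine Submodule.span_le.2 ?_
      rintro _ ⟨l, rfl⟩
      induction l with
      | nil => exact ⟨q, hqY, rfl⟩
      | cons a l ih =>
        obtain ⟨y, hy, e⟩ := ih
        obtain ⟨a, rfl⟩ := modCenter_surjective a
        refine ⟨⁅f a, y⁆, hY a y hy, ?_⟩
        rw [List.foldr_cons, ← e]
        rfl
    rintro y hy
    obtain ⟨y, hyY, rfl⟩ := hle hy
    obtain ⟨z, hz⟩ := hxY y hyY
    exact ⟨modCenter Φ L z, congrArg (modCenter Φ M) hz⟩

end GradedLie

/-! ### Gradings of skew elements -/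

section SkewGrading

variable {Φ R G : Type*} [CommRing Φ] [StarRing Φ] [TrivialStar Φ] [NonUnitalRing R] [StarRing R]
  [Module Φ R] [StarModule Φ R]

theorem Skew.star_coe (x : Skew Φ R) : star (x : R) = -x := x.2

theorem IsGradingProj.skewGrading {ℛ : G → Submodule Φ R} {π : G → R →ₗ[Φ] R}
    (h : IsGradingProj ℛ π) (hstar : ∀ σ, ∀ a ∈ ℛ σ, star a ∈ ℛ σ) :
    ∃ π' : G → Skew Φ R →ₗ[Φ] Skew Φ R, IsGradingProj (skewGrading ℛ) π' ∧
      ∀ σ x, (π' σ x : R) = π σ x := by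
  have hN : ∀ σ, ∀ x ∈ skewAdjoint.submodule Φ R, π σ x ∈ skewAdjoint.submodule Φ R := by
    intro σ x hx
    have hx : star x = -x := hx
    have := h.proj_map h (starAddEquiv : R ≃+ R).toAddMonoidHom (g := id) Function.injective_id
      hstar σ x
    change star (π σ x) = -π σ x
    rw [← map_neg, ← hx]
    exact this.symm
  exact ⟨_, h.comap hN, fun _ _ => rfl⟩

variable [IsScalarTower Φ R R] [SMulCommClass Φ R R]

theorem Skew.mem_center_iff {z : Skew Φ R} : z ∈ LieAlgebra.center Φ (Skew Φ R) ↔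
    ∀ k : R, star k = -k → (z : R) * k = k * z := by
  rw [mem_center_iff']
  refine ⟨fun h k hk => sub_eq_zero.1 (congrArg Subtype.val (h ⟨k, hk⟩)),
    fun h k => Subtype.ext (sub_eq_zero.2 (h k k.2))⟩

theorem Skew.mem_center_derived_of_commute {z : Derived Φ (Skew Φ R)}
    (h : ∀ k : R, star k = -k → ((z : Skew Φ R) : R) * k = k * (z : Skew Φ R)) :
    z ∈ LieAlgebra.center Φ (Derived Φ (Skew Φ R)) :=
  mem_center_iff'.2 fun x => Subtype.ext (mem_center_iff'.1 (Skew.mem_center_iff.2 h) x)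

theorem Skew.commute_of_mem_center_derived {z : Derived Φ (Skew Φ R)}
    (h : z ∈ LieAlgebra.center Φ (Derived Φ (Skew Φ R))) {k l : R} (hk : star k = -k)
    (hl : star l = -l) :
    ((z : Skew Φ R) : R) * (k * l - l * k) = (k * l - l * k) * (z : Skew Φ R) := by
  have := mem_center_iff'.1 h
    ⟨⁅(⟨k, hk⟩ : Skew Φ R), (⟨l, hl⟩ : Skew Φ R)⁆, lie_mem_Derived _ _⟩
  replace this := congrArg (fun x : Derived Φ (Skew Φ R) => ((x : Skew Φ R) : R)) this
  exact sub_eq_zero.1 this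

instance [AddCommGroup G] {ℛ : G → Submodule Φ R} [SetLike.GradedMul ℛ] :
    SetLike.GradedBracket (skewGrading ℛ) where
  bracket_mem i j _ _ hx hy := sub_mem (SetLike.GradedMul.mul_mem (A := ℛ) hx hy)
    (add_comm j i ▸ SetLike.GradedMul.mul_mem (A := ℛ) hy hx)

end SkewGrading

/-! ### Skew elements of algebras of quotients -/

namespace Martindale.Qs

variable {Φ A G : Type*} [CommRing Φ] [StarRing Φ] [TrivialStar Φ] [AddCommGroup G]
  [NonUnitalRing A] [Module Φ A] [IsScalarTower Φ A A] [SMulCommClass Φ A A]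
  [StarRing A] [StarModule Φ A] [IsSemiprimeAlg A]
  {𝒜 : G → Submodule Φ A} {Q : NonUnitalStarSubalgebra Φ (Qs Φ A)}
  (hAQ : ∀ a, incl Φ A a ∈ Q) {𝒬 : G → Submodule Φ Q}

theorem skewIncl_injective : Function.Injective (skewIncl Q hAQ) := fun _ _ h =>
  Subtype.ext (inclSub_injective Q hAQ (congrArg Subtype.val h))

theorem mem_range_skewIncl {x : Skew Φ Q}
    (hx : (x : Q) ∈ (inclSub Q hAQ : A →ₗ[Φ] Q).range) : x ∈ (skewIncl Q hAQ).range := by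
  obtain ⟨a, ha⟩ := hx
  replace ha : inclSub Q hAQ a = x := ha
  refine ⟨⟨a, inclSub_injective Q hAQ ?_⟩, Subtype.ext ha⟩
  rw [map_star, map_neg, ha]
  exact x.2

/-- Multiplication by `q` shifts degrees by `τ`, so `a_σ q` is a homogeneous component of `aq`, and
`A` contains the components of its elements. In the conditions on `ab` and `ba`, the factor `b` is
first split into components. -/
theorem proj_mem_absorbIdeal [SetLike.GradedMul 𝒜] [SetLike.GradedMul 𝒬]
    {π : G → A →ₗ[Φ] A} {ρ : G → Q →ₗ[Φ] Q} (hπ : IsGradingProj 𝒜 π) (hρ : IsGradingProj 𝒬 ρ)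
    (hle : ∀ σ, ∀ a ∈ 𝒜 σ, inclSub Q hAQ a ∈ 𝒬 σ) {τ : G} {q : Q} (hq : q ∈ 𝒬 τ) (σ : G)
    {a : A} (ha : a ∈ absorbIdeal Q hAQ q) : π σ a ∈ absorbIdeal Q hAQ q := by
  have key : ∀ (f : A →+ Q) (τ : G), (∀ σ, ∀ x ∈ 𝒜 σ, f x ∈ 𝒬 (σ + τ)) →
      f a ∈ (inclSub Q hAQ : A →ₗ[Φ] Q).range →
      f (π σ a) ∈ (inclSub Q hAQ : A →ₗ[Φ] Q).range := by
    rintro f τ hf ⟨b, hb⟩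
    rw [← hπ.proj_map hρ f (g := (· + τ)) (add_left_injective τ) hf, ← hb]
    exact ⟨_, (hπ.proj_map hρ (inclSub Q hAQ : A →+ Q) (g := id) Function.injective_id
      hle (σ + τ) b).symm⟩
  obtain ⟨h1, h2, h3⟩ := ha
  have mul_mem : ∀ {i j} {x y : Q}, x ∈ 𝒬 i → y ∈ 𝒬 j → x * y ∈ 𝒬 (i + j) :=
    fun hx hy => SetLike.GradedMul.mul_mem hx hy
  refine ⟨key ((AddMonoidHom.mulRight q).comp (inclSub Q hAQ : A →+ Q)) τ
      (fun σ x hx => mul_mem (hle σ x hx) hq) h1,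
    key ((AddMonoidHom.mulLeft q).comp (inclSub Q hAQ : A →+ Q)) τ
      (fun σ x hx => add_comm τ σ ▸ mul_mem hq (hle σ x hx)) h2, fun b => ⟨?_, ?_⟩⟩
  · obtain ⟨s, hs⟩ := hπ.sum b
    rw [← hs, Finset.mul_sum, map_sum, Finset.sum_mul]
    refine sum_mem fun β _ => key (((AddMonoidHom.mulRight q).comp
      (inclSub Q hAQ : A →+ Q)).comp (AddMonoidHom.mulRight (π β b))) (β + τ)
      (fun σ x hx => ?_) (h3 _).1
    rw [← add_assoc]
    exact mul_mem (hle _ _ (SetLike.GradedMul.mul_mem hx (hπ.mem β b))) hq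
  · obtain ⟨s, hs⟩ := hπ.sum b
    rw [← hs, Finset.sum_mul, map_sum, Finset.mul_sum]
    refine sum_mem fun β _ => key (((AddMonoidHom.mulLeft q).comp
      (inclSub Q hAQ : A →+ Q)).comp (AddMonoidHom.mulLeft (π β b))) (β + τ)
      (fun σ x hx => ?_) (h3 _).2
    rw [show σ + (β + τ) = τ + (β + σ) by abel]
    exact mul_mem hq (hle _ _ (SetLike.GradedMul.mul_mem (hπ.mem β b) hx))

/-- `A` itself is one of the dense `*`-ideals, so what commutes with `K_A` commutes with `K_Q`. -/
theorem skewIncl_mem_center (h2 : ∀ a : A, a + a = 0 → a = 0) {z : Skew Φ A}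
    (hz : ∀ k : A, star k = -k → (z : A) * k = k * z) {q : Q} (hq : star q = -q) :
    (skewIncl Q hAQ z : Q) * q = q * skewIncl Q hAQ z := by
  obtain ⟨J, hJ, hmem⟩ := exists_mem_denseFamily Q hAQ (isDenseIdeal_top (Φ := Φ) (A := A))
    fun _ _ => trivial
  refine (isDenseFamily Q hAQ).commute_skew_of_commute_skew_mem
    (fun a ha => Subtype.ext (eq_zero_of_add_self h2 _ (congrArg Subtype.val ha))) hJ
    (skewIncl Q hAQ z).2 (fun x hx hx' => ?_) hq
  obtain ⟨k, -, rfl⟩ := (hmem x).1 hx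
  have hk : star k = -k := inclSub_injective Q hAQ (by rw [map_star, map_neg]; exact hx')
  change inclSub Q hAQ z * inclSub Q hAQ k = inclSub Q hAQ k * inclSub Q hAQ z
  rw [← map_mul, ← map_mul, hz k hk]

/-- The skew elements `y` of `Q` with `I y ⊆ A` and `y I ⊆ A`. -/
def absorbedSkew (I : Submodule Φ A) : Submodule Φ (Skew Φ Q) :=
  (absorbed Q hAQ I).comap (skewAdjoint.submodule Φ Q).subtype

theorem lie_mem_absorbedSkew {I : Submodule Φ A} (hI : IsDenseIdeal I) (l : Skew Φ A)
    {y : Skew Φ Q} (hy : y ∈ absorbedSkew hAQ I) :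
    ⁅skewIncl Q hAQ l, y⁆ ∈ absorbedSkew hAQ I :=
  commutator_mem_absorbed Q hAQ hI (l : A) hy

theorem lie_mem_range_skewIncl {I : Submodule Φ A} {x : Skew Φ A} (hx : (x : A) ∈ I)
    {y : Skew Φ Q} (hy : y ∈ absorbedSkew hAQ I) :
    ⁅skewIncl Q hAQ x, y⁆ ∈ (skewIncl Q hAQ).range :=
  mem_range_skewIncl hAQ (sub_mem (hy _ hx).1 (hy _ hx).2)

theorem mem_absorbedSkew_absorbIdeal (q : Skew Φ Q) :
    q ∈ absorbedSkew hAQ (absorbIdeal Q hAQ (q : Q)) := fun _ ha => ⟨ha.1, ha.2.1⟩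

theorem isGradedAlgebraOfQuotients_skew [DecidableEq G] (h2 : ∀ a : A, a + a = 0 → a = 0)
    [SetLike.GradedMul 𝒜] [SetLike.GradedMul 𝒬]
    {π : G → A →ₗ[Φ] A} {ρ : G → Q →ₗ[Φ] Q} (hπ : IsGradingProj 𝒜 π) (hρ : IsGradingProj 𝒬 ρ)
    (hstar𝒜 : ∀ σ, ∀ a ∈ 𝒜 σ, star a ∈ 𝒜 σ) (hstar𝒬 : ∀ σ, ∀ q ∈ 𝒬 σ, star q ∈ 𝒬 σ)
    (hle : ∀ σ, ∀ a ∈ 𝒜 σ, inclSub Q hAQ a ∈ 𝒬 σ)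
    (hZ : ∀ z ∈ LieAlgebra.center Φ (Skew Φ A),
      skewIncl Q hAQ z ∈ LieAlgebra.center Φ (Skew Φ Q)) :
    IsGradedAlgebraOfQuotients (modCenterMap (skewIncl Q hAQ) hZ)
      (modCenterGrading (skewGrading 𝒜)) (modCenterGrading (skewGrading 𝒬)) := by
  obtain ⟨π', hπ', hπ'_coe⟩ := hπ.skewGrading hstar𝒜
  obtain ⟨ρ', hρ', -⟩ := hρ.skewGrading hstar𝒬
  refine isGradedAlgebraOfQuotients_modCenterMap hZ hπ' hρ' (skewIncl_injective hAQ)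
    (fun σ x hx => hle σ x hx) fun p hp τ q hq => ?_
  have hI := isDenseIdeal_absorbIdeal Q hAQ (q : Q)
  obtain ⟨J, hJ, hmem⟩ := exists_mem_denseFamily Q hAQ hI
    fun _ => star_mem_absorbIdeal Q hAQ (Skew.star_coe q)
  suffices h : ∃ α, ∃ x ∈ skewGrading 𝒜 α, (x : A) ∈ absorbIdeal Q hAQ (q : Q) ∧
      ⁅skewIncl Q hAQ x, p⁆ ∉ LieAlgebra.center Φ (Skew Φ Q) by
    obtain ⟨α, x, hx, hxI, hxp⟩ := h
    exact ⟨α, x, hx, hxp, absorbedSkew hAQ (absorbIdeal Q hAQ (q : Q)),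
      mem_absorbedSkew_absorbIdeal hAQ q, fun l _ hy => lie_mem_absorbedSkew hAQ hI l hy,
      fun _ hy => lie_mem_range_skewIncl hAQ hxI hy⟩
  -- Otherwise `[p, x]` is central for all homogeneous skew `x` in the ideal, hence, the ideal being
  -- graded, for all skew `x` in it, and `p` is central.
  by_contra! hcon
  have hall := hπ'.sub_induction
    (N := (absorbIdeal Q hAQ (q : Q)).comap (skewAdjoint.submodule Φ A).subtype)
    (P := (LieAlgebra.center Φ (Skew Φ Q)).toSubmodule)
    (fun σ x hx => by
      change (π' σ x : A) ∈ absorbIdeal Q hAQ (q : Q)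
      rw [hπ'_coe]
      exact proj_mem_absorbIdeal hAQ hπ hρ hle hq σ hx)
    (LieAlgebra.ad Φ (Skew Φ Q) p ∘ₗ (skewIncl Q hAQ : Skew Φ A →ₗ[Φ] Skew Φ Q))
    (fun σ x hx hxσ => by
      change ⁅p, skewIncl Q hAQ x⁆ ∈ LieAlgebra.center Φ (Skew Φ Q)
      rw [← lie_skew]
      exact neg_mem (hcon σ x hxσ hx))
  refine hp (Skew.mem_center_iff.2 fun k hk =>
    (isDenseFamily Q hAQ).commute_skew_of_commutator
      (fun a ha => Subtype.ext (eq_zero_of_add_self h2 _ (congrArg Subtype.val ha))) hJ p.2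
      (fun x hx hx' l hl => ?_) hk)
  obtain ⟨a, ha, rfl⟩ := (hmem x).1 hx
  have ha' : star a = -a := inclSub_injective Q hAQ (by rw [map_star, map_neg]; exact hx')
  exact Skew.mem_center_iff.1 (hall ⟨a, ha'⟩ ha) l hl

/-- The absorbing element is a bracket `[x, y]` of homogeneous skew elements of the ideal: `[[x, y],
z] = [x, [y, z]] - [y, [x, z]]` lies in `[K_A, K_A]` since `[y, z]` and `[x, z]` lie in `K_A`. -/
theorem isGradedAlgebraOfQuotients_derived_skew [DecidableEq G]
    (h2 : ∀ a : A, a + a = 0 → a = 0)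
    [SetLike.GradedMul 𝒜] [SetLike.GradedMul 𝒬]
    {π : G → A →ₗ[Φ] A} {ρ : G → Q →ₗ[Φ] Q} (hπ : IsGradingProj 𝒜 π) (hρ : IsGradingProj 𝒬 ρ)
    (hstar𝒜 : ∀ σ, ∀ a ∈ 𝒜 σ, star a ∈ 𝒜 σ) (hstar𝒬 : ∀ σ, ∀ q ∈ 𝒬 σ, star q ∈ 𝒬 σ)
    (hle : ∀ σ, ∀ a ∈ 𝒜 σ, inclSub Q hAQ a ∈ 𝒬 σ)
    (hZ : ∀ z ∈ LieAlgebra.center Φ (Derived Φ (Skew Φ A)),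
      derivedMap (skewIncl Q hAQ) z ∈ LieAlgebra.center Φ (Derived Φ (Skew Φ Q))) :
    IsGradedAlgebraOfQuotients (modCenterMap (derivedMap (skewIncl Q hAQ)) hZ)
      (modCenterGrading (derivedGrading (skewGrading 𝒜)))
      (modCenterGrading (derivedGrading (skewGrading 𝒬))) := by
  obtain ⟨π', hπ', hπ'_coe⟩ := hπ.skewGrading hstar𝒜
  obtain ⟨ρ', hρ', -⟩ := hρ.skewGrading hstar𝒬
  obtain ⟨π'', hπ''⟩ := hπ'.derivedGrading
  obtain ⟨ρ'', hρ''⟩ := hρ'.derivedGrading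
  refine isGradedAlgebraOfQuotients_modCenterMap hZ hπ'' hρ''
    (derivedMap_injective (skewIncl_injective hAQ))
    (fun σ x hx => hle σ _ hx) fun p hp τ q hq => ?_
  have hI := isDenseIdeal_absorbIdeal Q hAQ ((q : Skew Φ Q) : Q)
  obtain ⟨J, hJ, hmem⟩ := exists_mem_denseFamily Q hAQ hI
    fun _ => star_mem_absorbIdeal Q hAQ (Skew.star_coe (q : Skew Φ Q))
  suffices h : ∃ α β, ∃ x ∈ skewGrading 𝒜 α, ∃ y ∈ skewGrading 𝒜 β,
      (x : A) ∈ absorbIdeal Q hAQ ((q : Skew Φ Q) : Q) ∧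
      (y : A) ∈ absorbIdeal Q hAQ ((q : Skew Φ Q) : Q) ∧
      ⁅derivedMap (skewIncl Q hAQ) ⟨⁅x, y⁆, lie_mem_Derived x y⟩, p⁆ ∉
        LieAlgebra.center Φ (Derived Φ (Skew Φ Q)) by
    obtain ⟨α, β, x, hx, y, hy, hxI, hyI, hxp⟩ := h
    refine ⟨α + β, ⟨⁅x, y⁆, lie_mem_Derived x y⟩,
      SetLike.GradedBracket.bracket_mem (ℒ := skewGrading 𝒜) hx hy, hxp,
      (absorbedSkew hAQ (absorbIdeal Q hAQ ((q : Skew Φ Q) : Q))).comap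
        (Derived Φ (Skew Φ Q)).toSubmodule.subtype,
      mem_absorbedSkew_absorbIdeal hAQ (q : Skew Φ Q),
      fun l _ hy => lie_mem_absorbedSkew hAQ hI (l : Skew Φ A) hy, fun z hz => ?_⟩
    obtain ⟨a, ha⟩ := lie_mem_range_skewIncl hAQ hxI hz
    obtain ⟨b, hb⟩ := lie_mem_range_skewIncl hAQ hyI hz
    refine ⟨⟨⁅x, b⁆ - ⁅y, a⁆, sub_mem (lie_mem_Derived x b) (lie_mem_Derived y a)⟩,
      Subtype.ext ?_⟩
    change skewIncl Q hAQ (⁅x, b⁆ - ⁅y, a⁆) = ⁅skewIncl Q hAQ ⁅x, y⁆, (z : Skew Φ Q)⁆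
    replace ha : skewIncl Q hAQ a = _ := ha
    replace hb : skewIncl Q hAQ b = _ := hb
    rw [map_sub, LieHom.map_lie, LieHom.map_lie, LieHom.map_lie, ha, hb]
    exact (lie_lie _ _ _).symm
  by_contra! hcon
  have hN : ∀ σ, ∀ x ∈ (absorbIdeal Q hAQ ((q : Skew Φ Q) : Q)).comap
      (skewAdjoint.submodule Φ A).subtype, π' σ x ∈ (absorbIdeal Q hAQ
        ((q : Skew Φ Q) : Q)).comap (skewAdjoint.submodule Φ A).subtype := fun σ x hx => by
    change (π' σ x : A) ∈ absorbIdeal Q hAQ ((q : Skew Φ Q) : Q)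
    rw [hπ'_coe]
    exact proj_mem_absorbIdeal hAQ hπ hρ hle hq σ hx
  let B (x y : Skew Φ A) : Derived Φ (Skew Φ Q) :=
    ⁅derivedMap (skewIncl Q hAQ) ⟨⁅x, y⁆, lie_mem_Derived x y⟩, p⁆
  have B_coe (x y : Skew Φ A) :
      (B x y : Skew Φ Q) = ⁅skewIncl Q hAQ ⁅x, y⁆, (p : Skew Φ Q)⁆ := rfl
  -- Bilinearity of `(x, y) ↦ [[x, y], p]` lets the passage from homogeneous to arbitrary elements
  -- be made in each variable separately.
  let B' : Skew Φ A →ₗ[Φ] Skew Φ A →ₗ[Φ] Derived Φ (Skew Φ Q) := LinearMap.mk₂ Φ B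
    (fun _ _ _ => Subtype.ext (by simp [B_coe])) (fun _ _ _ => Subtype.ext (by simp [B_coe]))
    (fun _ _ _ => Subtype.ext (by simp [B_coe])) (fun _ _ _ => Subtype.ext (by simp [B_coe]))
  have hall := fun x hx => hπ'.sub_induction hN
    (P := (LieAlgebra.center Φ (Derived Φ (Skew Φ Q))).toSubmodule) (B' x)
    fun τ y hy hyτ => hπ'.sub_induction hN
      (P := (LieAlgebra.center Φ (Derived Φ (Skew Φ Q))).toSubmodule) (B'.flip y)
      (fun σ x hx hxσ => hcon σ τ x hxσ y hyτ hx hy) x hx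
  refine hp (Skew.mem_center_derived_of_commute fun k hk =>
    (isDenseFamily Q hAQ).commute_skew_of_commutator_derived
      (fun a ha => Subtype.ext (eq_zero_of_add_self h2 _ (congrArg Subtype.val ha))) hJ
      (p : Skew Φ Q).2 (fun x hx y hy hx' hy' k l hk hl => ?_) hk)
  obtain ⟨a, ha, rfl⟩ := (hmem x).1 hx
  obtain ⟨b, hb, rfl⟩ := (hmem y).1 hy
  have ha' : star a = -a := inclSub_injective Q hAQ (by rw [map_star, map_neg]; exact hx')
  have hb' : star b = -b := inclSub_injective Q hAQ (by rw [map_star, map_neg]; exact hy')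
  have := Skew.commute_of_mem_center_derived (neg_mem (hall ⟨a, ha'⟩ ha ⟨b, hb'⟩ hb)) hk hl
  have e : (((-B ⟨a, ha'⟩ ⟨b, hb'⟩ : Derived Φ (Skew Φ Q)) : Skew Φ Q) : Q) =
      (p : Skew Φ Q) * (inclSub Q hAQ a * inclSub Q hAQ b - inclSub Q hAQ b * inclSub Q hAQ a) -
      (inclSub Q hAQ a * inclSub Q hAQ b - inclSub Q hAQ b * inclSub Q hAQ a) *
        (p : Skew Φ Q) := by
    rw [← map_mul, ← map_mul, ← map_sub]
    exact neg_sub _ _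
  rw [← e]
  exact this

end Martindale.Qs

theorem mainTheorem4 {Φ A G : Type*} [CommRing Φ] [StarRing Φ] [TrivialStar Φ]
    [AddCommGroup G] [DecidableEq G]
    -- `A` is a semiprime algebra without 2-torsion, with an involution
    [NonUnitalRing A] [Module Φ A] [IsScalarTower Φ A A] [SMulCommClass Φ A A]
    [StarRing A] [StarModule Φ A] [IsSemiprimeAlg A]
    (h2 : ∀ a : A, a + a = 0 → a = 0)
    -- `A` is graded and the involution preserves the grading
    (𝒜 : G → Submodule Φ A) (h𝒜 : DirectSum.IsInternal 𝒜) [SetLike.GradedMul 𝒜]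
    (hstar𝒜 : ∀ σ, ∀ a ∈ 𝒜 σ, star a ∈ 𝒜 σ)
    -- `Q` is a `*`-subalgebra of `Q_s(A)` that contains `A`
    (Q : NonUnitalStarSubalgebra Φ (Martindale.Qs Φ A)) (hAQ : ∀ a, Martindale.Qs.incl Φ A a ∈ Q)
    -- `Q` is graded, `A` is a graded subalgebra of it, and the involution preserves the grading
    (𝒬 : G → Submodule Φ Q) (h𝒬 : DirectSum.IsInternal 𝒬) [SetLike.GradedMul 𝒬]
    (hstar𝒬 : ∀ σ, ∀ q ∈ 𝒬 σ, star q ∈ 𝒬 σ)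
    (hle : ∀ σ, ∀ a ∈ 𝒜 σ, (⟨Martindale.Qs.incl Φ A a, hAQ a⟩ : Q) ∈ 𝒬 σ) :
    (∃ φ : ModCenter Φ (Skew Φ A) →ₗ⁅Φ⁆ ModCenter Φ (Skew Φ Q),
      (∀ x, φ (modCenter Φ _ x) = modCenter Φ _ (Martindale.Qs.skewIncl Q hAQ x)) ∧
      IsGradedAlgebraOfQuotients φ (modCenterGrading (skewGrading 𝒜))
        (modCenterGrading (skewGrading 𝒬))) ∧
    (∃ φ : ModCenter Φ (Derived Φ (Skew Φ A)) →ₗ⁅Φ⁆ ModCenter Φ (Derived Φ (Skew Φ Q)),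
      (∀ x, φ (modCenter Φ _ x) = modCenter Φ _ (derivedMap (Martindale.Qs.skewIncl Q hAQ) x)) ∧
      IsGradedAlgebraOfQuotients φ (modCenterGrading (derivedGrading (skewGrading 𝒜)))
        (modCenterGrading (derivedGrading (skewGrading 𝒬)))) := by
  obtain ⟨π, hπ⟩ := h𝒜.exists_isGradingProj
  obtain ⟨ρ, hρ⟩ := h𝒬.exists_isGradingProj
  have hZ : ∀ z ∈ LieAlgebra.center Φ (Skew Φ A),
      Martindale.Qs.skewIncl Q hAQ z ∈ LieAlgebra.center Φ (Skew Φ Q) := fun z hz =>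
    Skew.mem_center_iff.2 fun _ hq =>
      Martindale.Qs.skewIncl_mem_center hAQ h2 (Skew.mem_center_iff.1 hz) hq
  have hZ' : ∀ z ∈ LieAlgebra.center Φ (Derived Φ (Skew Φ A)),
      derivedMap (Martindale.Qs.skewIncl Q hAQ) z ∈
        LieAlgebra.center Φ (Derived Φ (Skew Φ Q)) := fun z hz =>
    -- A central element of `[K_A, K_A]` commutes with `K_A` by `commute_skew_of_commute_derived`,
    -- hence with `K_Q`.
    Skew.mem_center_derived_of_commute fun _ hq =>
      Martindale.Qs.skewIncl_mem_center hAQ h2 (fun _ hk =>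
        commute_skew_of_commute_derived h2 (z : Skew Φ A).2 (fun a b c ha hb _ => by
          rw [Skew.commute_of_mem_center_derived hz ha hb, sub_self, zero_mul, mul_zero]) hk) hq
  exact ⟨⟨modCenterMap _ hZ, fun _ => rfl,
      Martindale.Qs.isGradedAlgebraOfQuotients_skew hAQ h2 hπ hρ hstar𝒜 hstar𝒬 hle hZ⟩,
    ⟨modCenterMap _ hZ', fun _ => rfl,
      Martindale.Qs.isGradedAlgebraOfQuotients_derived_skew hAQ h2 hπ hρ hstar𝒜 hstar𝒬 hle hZ'⟩⟩
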